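/- **Setting.** Let $M=(m_1,\dots,m_n)$ with real $m_j\ge1$, $\min_j m_j=1$, and put $|M|=m_1+\dots+m_n$, $t^Mx=(t^{m_1}x_1,\dots,t^{m_n}x_n)$ for $t>0$, $x\in\mathbb R^n$. Let $[0]=0$ and, for $x\neq0$, let $[x]$ be the unique $t>0$ with $\sum_j (x_j/t^{m_j})^2=1$. Fix $\Psi\in C^\infty(\mathbb R)$ with $\Psi(t)=1$ for $0\le t\le\frac{11}{10}$ and $\Psi(t)=0$ for $t\ge\frac{13}{10}$; put $\Psi_j(\xi)=\Psi(2^{-j}[\xi])$ for $j\ge0$, $\Psi_{-1}=0$, $\Phi_j=\Psi_j-\Psi_{j-1}$ for $j\ge 0$. With $\mathcal Fu(\xi)=\int e^{-ix\cdot\xi}u(x)\,dx$, $s\in\mathbb R$ and $p,q\in(0,\infty]$, the spaces $B^{M,s}_{p,q}(\mathbb R^n)$ and (for $p<\infty$) $F^{M,s}_{p,q}(\mathbb R^n)$ consist of the tempered distributions $u$ for which the quasi-norm $$\big\|\{2^{sj}\|\mathcal F^{-1}\Phi_j\mathcal Fu\|_{L_p}\}_{j\ge0}\big\|_{\ell_q},\qquad\text{respectively}\qquad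 \Big\|\,\big\|\{2^{sj}\mathcal F^{-1}\Phi_j\mathcal Fu(\cdot)\}_{j\ge0}\big\|_{\ell_q}\Big\|_{L_p},$$ is finite. For tempered distributions $u,v$, the product $\pi(u,v)$ is the limit in $\mathcal D'(\mathbb R^n)$, as $k\to\infty$, of $\mathcal F^{-1}(\psi_k\mathcal Fu)\cdot\mathcal F^{-1}(\psi_k\mathcal Fv)$ with $\psi_k(\xi)=\psi(2^{-kM}\xi)$, provided that this limit exists for every $\psi\in C_0^\infty(\mathbb R^n)$ equal to $1$ near $0$ and does not depend on $\psi$. **Theorem.** For $j=0,1,2$ let $A_j$ be either $B^{M,s_j}_{p_j,q_j}(\mathbb R^n)$ or $F^{M,s_j}_{p_j,q_j}(\mathbb R^n)$ (independently of each other). Suppose there is a constant $c<\infty$ such that $$\|f\cdot g\|_{A_2}\le c\,\|f\|_{A_0}\|g\|_{A_1}\quad\text{for all } f,g\in\mathcal S(\mathbb R^n),$$ or, alternatively, such that this holds with $f\cdot g$ replaced by $\pi(f,g)$. Then, with $1/\infty=0$ and $1/0=\infty$: 1. $s_0+s_1\ge|M|\big(\frac1{p_0}+\frac1{p_1}-1\big)$;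 2. $s_0+s_1\ge0$; 3. $s_2\le\min(s_0,s_1)$; 4. $\frac1{p_2}\le\frac1{p_0}+\frac1{p_1}$; 5. $s_2-\frac{|M|}{p_2}\le\min\big(s_0-\frac{|M|}{p_0},\,s_1-\frac{|M|}{p_1}\big)$; 6. $s_2-\frac{|M|}{p_2}\le s_0+s_1-|M|\big(\frac1{p_0}+\frac1{p_1}\big)$; 7. if $s_2-\frac{|M|}{p_2}=s_1-\frac{|M|}{p_1}$ and $s_0=\frac{|M|}{p_0}$, then $q_0\le1$ when $A_0$ is a Besov space, and $p_0\le1$ when $A_0$ is a Triebel–Lizorkin space. Moreover: * (1′) if $s_0+s_1=\frac{|M|}{p_0}+\frac{|M|}{p_1}-|M|$, then $\frac1{q_0}+\frac1{q_1}\ge1$ when $A_0$ and $A_1$ are Besov spaces, and $\frac1{q_0}+\frac1{p_1}\ge1$ when $A_0$ is a Besov space and $A_1$ is a Triebel–Lizorkin space; * (2′) if $s_0+s_1=0$, then $\frac1{q_0}+\frac1{q_1}\ge1$; * (3′) for $j=0,1$: if $s_2=s_j$, then $q_2\ge q_j$; * (5′) for $j=0,1$: if $s_2-\frac{|M|}{p_2}=s_j-\frac{|M|}{p_j}$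 and $A_j$ and $A_2$ are Besov spaces, then $q_2\ge q_j$; * (6′) if $s_2-\frac{|M|}{p_2}=s_0-\frac{|M|}{p_0}+s_1-\frac{|M|}{p_1}$ and $A_0,A_1,A_2$ are all Besov spaces, then $q_2\ge\big(\frac1{q_0}+\frac1{q_1}\big)^{-1}$. -/

import Mathlib

open MeasureTheory Filter
open scoped SchwartzMap FourierTransform ContDiff ENNReal NNReal Topology

noncomputable section

/-! ### Anisotropic weights -/

/-- An anisotropic weight `M = (m₁, …, mₙ)`: real numbers `m_j ≥ 1` with `min_j m_j = 1`. -/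
structure AnisotropicWeight (n : ℕ) where
  m : Fin n → ℝ
  one_le : ∀ j, 1 ≤ m j
  exists_eq_one : ∃ j, m j = 1

namespace AnisotropicWeight

variable {n : ℕ} (M : AnisotropicWeight n)

/-- `|M| = m₁ + ⋯ + mₙ`. -/
def total : ℝ := ∑ j, M.m j

/-- The quasi-homogeneous dilation `x ↦ t^M x = (t^{m₁} x₁, …, t^{mₙ} xₙ)` for `t > 0`. -/
def dilation (t : ℝ) (ht : 0 < t) :
    EuclideanSpace ℝ (Fin n) ≃L[ℝ] EuclideanSpace ℝ (Fin n) :=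
  LinearEquiv.toContinuousLinearEquiv
    { toFun := fun x => WithLp.toLp 2 fun j => t ^ M.m j * x j
      invFun := fun x => WithLp.toLp 2 fun j => (t ^ M.m j)⁻¹ * x j
      map_add' := fun x y => by ext j; simp [mul_add]
      map_smul' := fun c x => by ext j; simp [mul_left_comm]
      left_inv := fun x => by
        ext j; simp [inv_mul_cancel_left₀ (Real.rpow_pos_of_pos ht (M.m j)).ne']
      right_inv := fun x => by
        ext j; simp [mul_inv_cancel_left₀ (Real.rpow_pos_of_pos ht (M.m j)).ne'] }

/-- The anisotropic distance `[x]`: `[0] = 0`, and for `x ≠ 0` the unique `t > 0` such that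
`∑ j, (x_j / t^{m_j})² = 1`. (For `x = 0` the set below is empty and its `sInf` is `0`; for `x ≠ 0`
it has exactly one element, see `size_spec` and `size_eq`.) -/
def size (x : EuclideanSpace ℝ (Fin n)) : ℝ :=
  sInf {t : ℝ | 0 < t ∧ ∑ j, (x j / t ^ M.m j) ^ 2 = 1}

theorem sum_le {x : EuclideanSpace ℝ (Fin n)} {t : ℝ} (ht : 1 ≤ t) :
    ∑ j, (x j / t ^ M.m j) ^ 2 ≤ ‖x‖ ^ 2 / t ^ 2 := by
  rw [EuclideanSpace.real_norm_sq_eq, Finset.sum_div]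
  refine Finset.sum_le_sum fun j _ => ?_
  rw [div_pow]
  have h1 : t ≤ t ^ M.m j := by
    simpa using Real.rpow_le_rpow_of_exponent_le ht (M.one_le j)
  gcongr

theorem le_sum {x : EuclideanSpace ℝ (Fin n)} {t : ℝ} (ht0 : 0 < t) (ht : t ≤ 1) :
    ‖x‖ ^ 2 / t ^ 2 ≤ ∑ j, (x j / t ^ M.m j) ^ 2 := by
  rw [EuclideanSpace.real_norm_sq_eq, Finset.sum_div]
  refine Finset.sum_le_sum fun j _ => ?_
  rw [div_pow]
  have h1 : t ^ M.m j ≤ t := by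
    simpa using Real.rpow_le_rpow_of_exponent_ge ht0 ht (M.one_le j)
  have h2 : 0 < t ^ M.m j := Real.rpow_pos_of_pos ht0 _
  gcongr

theorem sum_strictAnti {x : EuclideanSpace ℝ (Fin n)} (hx : x ≠ 0) {s t : ℝ} (hs : 0 < s)
    (hst : s < t) : ∑ j, (x j / t ^ M.m j) ^ 2 < ∑ j, (x j / s ^ M.m j) ^ 2 := by
  have hpow : ∀ j, s ^ M.m j < t ^ M.m j := fun j =>
    Real.rpow_lt_rpow hs.le hst (by linarith [M.one_le j])
  have hp : ∀ j, 0 < s ^ M.m j := fun j => Real.rpow_pos_of_pos hs _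
  obtain ⟨j, hj⟩ : ∃ j, x j ≠ 0 := by
    by_contra! h
    exact hx (by ext j; simpa using h j)
  refine Finset.sum_lt_sum (fun i _ => ?_) ⟨j, Finset.mem_univ _, ?_⟩
  · have := hp i
    have := hpow i
    rw [div_pow, div_pow]
    gcongr
  · have := hp j
    have := hpow j
    have : 0 < x j ^ 2 := by positivity
    rw [div_pow, div_pow]
    gcongr

theorem exists_size {x : EuclideanSpace ℝ (Fin n)} (hx : x ≠ 0) :
    ∃ t : ℝ, 0 < t ∧ ∑ j, (x j / t ^ M.m j) ^ 2 = 1 := by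
  have hx' : 0 < ‖x‖ := norm_pos_iff.mpr hx
  set a := min 1 ‖x‖
  set b := max 1 ‖x‖
  have ha : 0 < a := lt_min one_pos hx'
  have hab : a ≤ b := (min_le_left _ _).trans (le_max_left _ _)
  have hb : 0 < b := ha.trans_le hab
  have hc : ContinuousOn (fun t : ℝ => ∑ j, (x j / t ^ M.m j) ^ 2) (Set.Icc a b) := by
    refine continuousOn_finsetSum _ fun j _ => ContinuousOn.pow (ContinuousOn.div
      continuousOn_const ?_ ?_) 2
    · exact ContinuousOn.rpow_const continuousOn_id fun t ht => Or.inl (ha.trans_le ht.1).ne'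
    · exact fun t ht => (Real.rpow_pos_of_pos (ha.trans_le ht.1) _).ne'
  have h1 : 1 ≤ ∑ j, (x j / a ^ M.m j) ^ 2 := by
    refine le_trans ?_ (M.le_sum ha (min_le_left _ _))
    rw [one_le_div (by positivity)]
    gcongr
    exact min_le_right _ _
  have h2 : ∑ j, (x j / b ^ M.m j) ^ 2 ≤ 1 := by
    refine (M.sum_le (le_max_left _ _)).trans ?_
    rw [div_le_one (by positivity)]
    gcongr
    exact le_max_right _ _
  obtain ⟨t, ht, h⟩ := intermediate_value_Icc' hab hc ⟨h2, h1⟩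
  exact ⟨t, ha.trans_le ht.1, h⟩

theorem size_eq {x : EuclideanSpace ℝ (Fin n)} {t : ℝ} (ht : 0 < t)
    (h : ∑ j, (x j / t ^ M.m j) ^ 2 = 1) : M.size x = t := by
  have hx : x ≠ 0 := by
    rintro rfl
    simp at h
  have : {s : ℝ | 0 < s ∧ ∑ j, (x j / s ^ M.m j) ^ 2 = 1} = {t} := by
    ext s
    simp only [Set.mem_ofPred_eq, Set.mem_singleton_iff]
    refine ⟨fun hs => ?_, fun hs => hs ▸ ⟨ht, h⟩⟩
    rcases lt_trichotomy s t with hlt | heq | hlt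
    · have := M.sum_strictAnti hx hs.1 hlt
      linarith [hs.2]
    · exact heq
    · have := M.sum_strictAnti hx ht hlt
      linarith [hs.2]
  rw [size, this, csInf_singleton]

theorem size_spec {x : EuclideanSpace ℝ (Fin n)} (hx : x ≠ 0) :
    0 < M.size x ∧ ∑ j, (x j / M.size x ^ M.m j) ^ 2 = 1 := by
  obtain ⟨t, ht, h⟩ := M.exists_size hx
  rw [M.size_eq ht h]
  exact ⟨ht, h⟩

theorem size_zero : M.size 0 = 0 := by
  simp [size]

theorem size_le_one {x : EuclideanSpace ℝ (Fin n)} (hx : ‖x‖ < 1) : M.size x ≤ 1 := by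
  by_cases h0 : x = 0
  · simp [h0, size_zero]
  by_contra! h
  have h1 := (M.size_spec h0).2
  have h2 := M.sum_le (x := x) h.le
  rw [h1, one_le_div (by positivity)] at h2
  have h3 := abs_le_of_sq_le_sq h2 (norm_nonneg x)
  have := le_abs_self (M.size x)
  linarith

theorem abs_le_of_size_le {x : EuclideanSpace ℝ (Fin n)} {T : ℝ} (h : M.size x ≤ T)
    (j : Fin n) : |x j| ≤ T ^ M.m j := by
  by_cases h0 : x = 0
  · have : 0 ≤ T := by simpa [h0, size_zero] using h
    simp only [h0, PiLp.zero_apply, abs_zero]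
    positivity
  obtain ⟨hp, hs⟩ := M.size_spec h0
  have h1 : (x j / M.size x ^ M.m j) ^ 2 ≤ 1 := by
    rw [← hs]
    exact Finset.single_le_sum (f := fun j => (x j / M.size x ^ M.m j) ^ 2)
      (fun i _ => sq_nonneg _) (Finset.mem_univ j)
  have hq : 0 < M.size x ^ M.m j := Real.rpow_pos_of_pos hp _
  have h2 : |x j / M.size x ^ M.m j| ≤ 1 := by
    rwa [← sq_le_one_iff_abs_le_one]
  rw [abs_div, abs_of_pos hq, div_le_one hq] at h2
  exact h2.trans (Real.rpow_le_rpow hp.le h (by linarith [M.one_le j]))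

theorem contDiffAt_size {x₀ : EuclideanSpace ℝ (Fin n)} (hx : x₀ ≠ 0) :
    ContDiffAt ℝ ∞ M.size x₀ := by
  obtain ⟨ht, hs⟩ := M.size_spec hx
  set t₀ := M.size x₀
  let f : EuclideanSpace ℝ (Fin n) × ℝ → ℝ := fun v => ∑ j, (v.1 j / v.2 ^ M.m j) ^ 2
  have hf : ContDiffAt ℝ ∞ f (x₀, t₀) := by
    refine ContDiffAt.sum fun j _ => ContDiffAt.pow (ContDiffAt.div ?_ ?_ ?_) 2
    · fun_prop
    · exact ContDiffAt.rpow_const_of_ne contDiffAt_snd ht.ne'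
    · exact (Real.rpow_pos_of_pos ht _).ne'
  have hd : HasDerivAt (fun t => f (x₀, t))
      (∑ j, -(2 * M.m j / t₀ * (x₀ j / t₀ ^ M.m j) ^ 2)) t₀ := by
    refine HasDerivAt.fun_sum fun j _ => ?_
    have hp : t₀ ^ M.m j ≠ 0 := (Real.rpow_pos_of_pos ht _).ne'
    have h1 := (((hasDerivAt_const t₀ (x₀ j)).div
      (Real.hasDerivAt_rpow_const (p := M.m j) (Or.inl ht.ne')) hp).pow 2)
    refine h1.congr_deriv ?_
    rw [Real.rpow_sub_one ht.ne']
    simp only [Pi.div_apply]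
    generalize t₀ ^ M.m j = a at hp
    have := ht.ne'
    field_simp
    norm_num
    field_simp
  have hneg : (∑ j, -(2 * M.m j / t₀ * (x₀ j / t₀ ^ M.m j) ^ 2)) ≠ 0 := by
    rw [Finset.sum_neg_distrib]
    have : 2 / t₀ ≤ ∑ j, (2 * M.m j / t₀ * (x₀ j / t₀ ^ M.m j) ^ 2) := by
      calc 2 / t₀ = ∑ j, (2 / t₀ * (x₀ j / t₀ ^ M.m j) ^ 2) := by
            rw [← Finset.mul_sum, hs, mul_one]
        _ ≤ _ := by
            refine Finset.sum_le_sum fun j _ => ?_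
            have := M.one_le j
            gcongr
            linarith
    have : 0 < 2 / t₀ := by positivity
    linarith
  have hn : (∞ : WithTop ℕ∞) ≠ 0 := by simp
  have hcomp : HasDerivAt (fun t => f (x₀, t))
      ((fderiv ℝ f (x₀, t₀) ∘L .inr ℝ (EuclideanSpace ℝ (Fin n)) ℝ) 1) t₀ := by
    have h1 : HasFDerivAt f (fderiv ℝ f (x₀, t₀)) (x₀, t₀) :=
      (hf.differentiableAt hn).hasFDerivAt
    exact (h1.comp t₀ (hasFDerivAt_prodMk_right x₀ t₀)).hasDerivAt
  have hone := hcomp.unique hd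
  have hinv : (fderiv ℝ f (x₀, t₀) ∘L .inr ℝ (EuclideanSpace ℝ (Fin n)) ℝ).IsInvertible := by
    set L := fderiv ℝ f (x₀, t₀) ∘L .inr ℝ (EuclideanSpace ℝ (Fin n)) ℝ
    refine ⟨ContinuousLinearEquiv.unitsEquivAut ℝ (Units.mk0 (L 1) (hone ▸ hneg)), ?_⟩
    ext
    simp
  have hg := hf.contDiffAt_implicitFunction hn hinv
  refine hg.congr_of_eventuallyEq ?_
  have h1 := hf.eventually_apply_implicitFunction hn hinv
  have h2 : ∀ᶠ x in 𝓝 x₀, 0 < hf.implicitFunction hn hinv x := by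
    refine hg.continuousAt.eventually_const_lt ?_
    have := hf.implicitFunction_apply_self hn hinv
    simp only at this
    rw [this]
    exact ht
  filter_upwards [h1, h2] with x hx1 hx2
  exact M.size_eq hx2 (hx1.trans hs)

end AnisotropicWeight

/-! ### The dyadic partition of unity -/

/-- A smooth function `Ψ` on `ℝ` with `Ψ(t) = 1` for `0 ≤ t ≤ 11/10` and `Ψ(t) = 0` for
`t ≥ 13/10`. -/
structure DyadicCutoff where
  toFun : ℝ → ℂ
  smooth : ContDiff ℝ ∞ toFun
  eq_one : ∀ t, 0 ≤ t → t ≤ 11 / 10 → toFun t = 1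
  eq_zero : ∀ t, 13 / 10 ≤ t → toFun t = 0

namespace DyadicCutoff

variable {n : ℕ} (Ψ : DyadicCutoff) (M : AnisotropicWeight n)

/-- `Ψ_j(ξ) = Ψ(2^{-j} [ξ])` for `j ≥ 0`, and `Ψ_j = 0` for `j < 0`. -/
def low (j : ℤ) (ξ : EuclideanSpace ℝ (Fin n)) : ℂ :=
  if 0 ≤ j then Ψ.toFun ((2 : ℝ) ^ (-j) * M.size ξ) else 0

/-- `Φ_j = Ψ_j - Ψ_{j-1}`. -/
def dyadic (j : ℤ) (ξ : EuclideanSpace ℝ (Fin n)) : ℂ :=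
  Ψ.low M j ξ - Ψ.low M (j - 1) ξ

theorem low_contDiff (j : ℤ) : ContDiff ℝ ∞ (Ψ.low M j) := by
  by_cases hj : 0 ≤ j
  · have h2 : (2 : ℝ) ^ (-j) ≤ 1 := zpow_le_one_of_nonpos₀ (by norm_num) (by omega)
    have h2' : (0 : ℝ) < 2 ^ (-j) := by positivity
    rw [contDiff_iff_contDiffAt]
    intro ξ
    by_cases h0 : ξ = 0
    · subst h0
      refine (contDiffAt_const (c := (1 : ℂ))).congr_of_eventuallyEq ?_
      filter_upwards [Metric.ball_mem_nhds _ one_pos] with x hx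
      have h1 : M.size x ≤ 1 := M.size_le_one (by simpa using hx)
      have h3 : 0 ≤ M.size x := by
        by_cases hx0 : x = 0
        · simp [hx0, M.size_zero]
        · exact (M.size_spec hx0).1.le
      simp only [low, if_pos hj]
      exact Ψ.eq_one _ (by positivity) (by nlinarith)
    · have : Ψ.low M j = fun ξ => Ψ.toFun ((2 : ℝ) ^ (-j) * M.size ξ) := by
        ext ξ; simp [low, hj]
      rw [this]
      exact (Ψ.smooth.contDiffAt).comp ξ (contDiffAt_const.mul (M.contDiffAt_size h0))
  · have : Ψ.low M j = fun _ => 0 := by ext ξ; simp [low, hj]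
    rw [this]
    exact contDiff_const

theorem low_hasCompactSupport (j : ℤ) : HasCompactSupport (Ψ.low M j) := by
  refine HasCompactSupport.of_support_subset_isCompact
    (K := Metric.closedBall 0 √(∑ i, (((13 / 10 : ℝ) * 2 ^ j) ^ M.m i) ^ 2))
    (isCompact_closedBall _ _) fun ξ hξ => ?_
  have hlt : M.size ξ ≤ (13 / 10 : ℝ) * 2 ^ j := by
    by_contra! h
    apply hξ
    by_cases hj : 0 ≤ j
    · simp only [low, if_pos hj]
      apply Ψ.eq_zero
      rw [zpow_neg, inv_mul_eq_div, le_div_iff₀ (by positivity)]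
      exact h.le
    · simp [low, hj]
  rw [mem_closedBall_zero_iff, EuclideanSpace.norm_eq]
  apply Real.sqrt_le_sqrt
  refine Finset.sum_le_sum fun i _ => ?_
  have := M.abs_le_of_size_le hlt i
  rw [Real.norm_eq_abs]
  gcongr

/-- `Φ_j`, as a Schwartz function. -/
def dyadicSchwartz (j : ℕ) : 𝓢(EuclideanSpace ℝ (Fin n), ℂ) :=
  HasCompactSupport.toSchwartzMap (f := Ψ.dyadic M j)
    ((Ψ.low_hasCompactSupport M j).sub (Ψ.low_hasCompactSupport M (j - 1)))
    ((Ψ.low_contDiff M j).sub (Ψ.low_contDiff M (j - 1)))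

end DyadicCutoff

/-! ### Frequency localisation `𝓕⁻¹ χ 𝓕 u`

With the Fourier transform `û(ξ) = ∫ e^{-i x·ξ} u(x) dx`, the distribution `𝓕⁻¹(χ û)` is, for
`χ ∈ C₀^∞`, the smooth function `x ↦ (2π)^{-n} ⟨û, e^{i x·} χ⟩`. In terms of Mathlib's Fourier
transform `𝓕 u (η) = ∫ e^{-2πi x·η} u(x) dx = û(2πη)`, this is
`x ↦ ⟨𝓕 u, e^{2πi x·} χ(2π·)⟩`. -/

section Localisation

variable {n : ℕ}

/-- Multiplication by `2π` on `ℝⁿ`. -/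
def twoPiScaling (n : ℕ) : EuclideanSpace ℝ (Fin n) ≃L[ℝ] EuclideanSpace ℝ (Fin n) :=
  ContinuousLinearEquiv.smulLeft (Units.mk0 (2 * Real.pi) Real.two_pi_pos.ne')

theorem planeWave_hasTemperateGrowth (x : EuclideanSpace ℝ (Fin n)) :
    Function.HasTemperateGrowth fun η : EuclideanSpace ℝ (Fin n) =>
      Complex.exp (2 * Real.pi * Complex.I * (inner ℝ x η : ℝ)) := by
  have h : Function.HasTemperateGrowth fun t : ℝ => Complex.exp (2 * Real.pi * Complex.I * t) := by
    refine ⟨contDiff_const.mul Complex.ofRealCLM.contDiff |>.cexp, fun k => ⟨0, (2 * Real.pi) ^ k, fun t => ?_⟩⟩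
    rw [norm_iteratedFDeriv_eq_norm_iteratedDeriv]
    have : ∀ k : ℕ, iteratedDeriv k (fun t : ℝ => Complex.exp (2 * Real.pi * Complex.I * t)) =
        fun t : ℝ => (2 * Real.pi * Complex.I) ^ k * Complex.exp (2 * Real.pi * Complex.I * t) := by
      intro k
      induction k with
      | zero => simp
      | succ k ih =>
        rw [iteratedDeriv_succ, ih]
        ext t
        have h1 : HasDerivAt (fun t : ℝ => (2 * Real.pi * Complex.I) * (t : ℂ))
            (2 * Real.pi * Complex.I) t := by
          simpa using (Complex.ofRealCLM.hasDerivAt (x := t)).const_mul (2 * Real.pi * Complex.I)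
        rw [(h1.cexp.const_mul _).deriv]
        ring
    rw [this k]
    have h2 : (2 * Real.pi * Complex.I * t : ℂ) = ((2 * Real.pi * t : ℝ) : ℂ) * Complex.I := by
      push_cast; ring
    beta_reduce
    rw [norm_mul, h2, Complex.norm_exp_ofReal_mul_I]
    simp [abs_of_pos Real.pi_pos]
  exact h.comp (Function.hasTemperateGrowth_inner_right x)

/-- The Schwartz function `η ↦ e^{2πi x·η} χ(2πη)`. -/
def waveTest (χ : 𝓢(EuclideanSpace ℝ (Fin n), ℂ)) (x : EuclideanSpace ℝ (Fin n)) :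
    𝓢(EuclideanSpace ℝ (Fin n), ℂ) :=
  SchwartzMap.smulLeftCLM ℂ (fun η => Complex.exp (2 * Real.pi * Complex.I * (inner ℝ x η : ℝ)))
    (SchwartzMap.compCLMOfContinuousLinearEquiv ℂ (twoPiScaling n) χ)

theorem waveTest_apply (χ : 𝓢(EuclideanSpace ℝ (Fin n), ℂ)) (x η : EuclideanSpace ℝ (Fin n)) :
    waveTest χ x η =
      Complex.exp (2 * Real.pi * Complex.I * (inner ℝ x η : ℝ)) * χ ((2 * Real.pi) • η) := by
  rw [waveTest, SchwartzMap.smulLeftCLM_apply_apply (planeWave_hasTemperateGrowth x)]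
  rfl

/-- The function `𝓕⁻¹ χ 𝓕 u` for a tempered distribution `u`. -/
def bandPart (χ : 𝓢(EuclideanSpace ℝ (Fin n), ℂ)) (u : 𝓢'(EuclideanSpace ℝ (Fin n), ℂ))
    (x : EuclideanSpace ℝ (Fin n)) : ℂ :=
  𝓕 u (waveTest χ x)

end Localisation

/-! ### Besov and Triebel–Lizorkin spaces -/

/-- The (quasi-)norm of `ℓ_q(ℕ₀)`, `0 < q ≤ ∞`, of a sequence of non-negative numbers. -/
def ellNorm (q : ℝ≥0∞) (a : ℕ → ℝ≥0∞) : ℝ≥0∞ :=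
  if q = ⊤ then ⨆ j, a j else (∑' j, a j ^ q.toReal) ^ (1 / q.toReal)

/-- The two scales: Besov (`B`) and Triebel–Lizorkin (`F`). -/
inductive Scale where
  | B
  | F

/-- The parameters of an anisotropic space `B^{M,s}_{p,q}` or `F^{M,s}_{p,q}`: `s ∈ ℝ` and
`p, q ∈ (0, ∞]`, where `p < ∞` in the Triebel–Lizorkin case. -/
structure SpaceParams where
  scale : Scale
  s : ℝ
  p : ℝ≥0∞
  q : ℝ≥0∞
  p_pos : 0 < p
  q_pos : 0 < q
  p_lt_top : scale = Scale.F → p < ⊤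

/-- The real number `1/p`, with `1/∞ = 0`. -/
def SpaceParams.recip (A : SpaceParams) : ℝ := (A.p⁻¹).toReal

/-- The (quasi-)norm of a tempered distribution in `B^{M,s}_{p,q}(ℝⁿ)` or `F^{M,s}_{p,q}(ℝⁿ)`; the
space consists of the tempered distributions for which it is finite. -/
def spaceNorm {n : ℕ} (M : AnisotropicWeight n) (Ψ : DyadicCutoff) (A : SpaceParams)
    (u : 𝓢'(EuclideanSpace ℝ (Fin n), ℂ)) : ℝ≥0∞ :=
  match A.scale with
  | Scale.B => ellNorm A.q fun j =>
      (2 : ℝ≥0∞) ^ (A.s * j) * eLpNorm (bandPart (Ψ.dyadicSchwartz M j) u) A.p volume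
  | Scale.F => eLpNorm (fun x => ellNorm A.q fun j =>
      (2 : ℝ≥0∞) ^ (A.s * j) * ‖bandPart (Ψ.dyadicSchwartz M j) u x‖ₑ) A.p volume

/-! ### Products -/

/-- The pointwise product `f · g` of two Schwartz functions. -/
def schwartzMul {n : ℕ} (f g : 𝓢(EuclideanSpace ℝ (Fin n), ℂ)) :
    𝓢(EuclideanSpace ℝ (Fin n), ℂ) :=
  SchwartzMap.pairing (ContinuousLinearMap.mul ℂ ℂ) f g

theorem schwartzMul_apply {n : ℕ} (f g : 𝓢(EuclideanSpace ℝ (Fin n), ℂ))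
    (x : EuclideanSpace ℝ (Fin n)) : schwartzMul f g x = f x * g x := rfl

/-- `IsProduct M u v w` says that the product `π(u, v)` is defined and equal to `w`: for every
`ψ ∈ C₀^∞(ℝⁿ)` that equals `1` on a neighbourhood of `0`, the functions
`𝓕⁻¹(ψ_k 𝓕 u) · 𝓕⁻¹(ψ_k 𝓕 v)`, where `ψ_k(ξ) = ψ(2^{-kM} ξ)`, converge to `w` in the space of
distributions as `k → ∞`. -/
def IsProduct {n : ℕ} (M : AnisotropicWeight n) (u v w : 𝓢'(EuclideanSpace ℝ (Fin n), ℂ)) : Prop :=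
  ∀ ψ : 𝓢(EuclideanSpace ℝ (Fin n), ℂ), HasCompactSupport ψ → (∀ᶠ ξ in 𝓝 0, ψ ξ = 1) →
    ∀ φ : 𝓢(EuclideanSpace ℝ (Fin n), ℂ), HasCompactSupport φ →
      Tendsto
        (fun k : ℕ =>
          let ψk := SchwartzMap.compCLMOfContinuousLinearEquiv ℂ
            (M.dilation ((2 : ℝ) ^ (-(k : ℤ))) (by positivity)) ψ
          ∫ x, bandPart ψk u x * bandPart ψk v x * φ x)
        atTop (𝓝 (w φ))

end

/-!
All conditions come from test functions built out of one fixed band-limited profile `f`. Moving it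
by a modulation of frequency `2^{kM} σ`, or by an anisotropic dilation followed by such a
modulation, puts its spectrum into a region where one `Φ_k` equals `1` and all the others vanish,
so the quasi-norm of a block is the power `2^{sk}` times an `L_p` quasi-norm. The product of two
blocks of opposite frequencies falls back to frequency `0`, the product of a block and `f` stays
at the frequency of the block, and the product of two equal dilated blocks moves up by one level.
Letting the level `k` tend to infinity and comparing exponents gives the conditions on `s` and
`p`. In a borderline case the powers of `2^k` balance, and one superposes `N` blocks instead, with
lacunary levels, so that the off-diagonal terms of the product do not interfere; the quasi-norms
then grow like powers `N^{1/q}`, or like `N^{1/p}` for dilated blocks in a Triebel–Lizorkin space,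
and `N → ∞` gives the conditions on the sum exponents. For Schwartz functions `π(f, g)` is
`f · g`, so both forms of the hypothesis lead to the same estimate.
-/

noncomputable section

variable {n : ℕ}

local notation "𝔼" => EuclideanSpace ℝ (Fin n)

/-! ### Anisotropic dilations -/

namespace AnisotropicWeight

variable (M : AnisotropicWeight n)

theorem total_pos : 0 < M.total := by
  obtain ⟨j, -⟩ := M.exists_eq_one
  exact Finset.sum_pos (fun i _ => one_pos.trans_le (M.one_le i)) ⟨j, Finset.mem_univ j⟩

theorem size_nonneg (x : 𝔼) : 0 ≤ M.size x := by
  by_cases h : x = 0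
  · rw [h, M.size_zero]
  · exact (M.size_spec h).1.le

theorem size_neg (x : 𝔼) : M.size (-x) = M.size x := by
  simp [size, neg_div]

section Dilation

variable {t : ℝ} (ht : 0 < t)

theorem dilation_apply (x : 𝔼) (j : Fin n) : M.dilation t ht x j = t ^ M.m j * x j := rfl

theorem size_dilation (x : 𝔼) : M.size (M.dilation t ht x) = t * M.size x := by
  by_cases h : x = 0
  · simp [h, M.size_zero]
  obtain ⟨hpos, hsum⟩ := M.size_spec h
  refine M.size_eq (by positivity) ?_
  rw [← hsum]
  refine Finset.sum_congr rfl fun j _ => ?_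
  rw [dilation_apply, Real.mul_rpow ht.le hpos.le,
    mul_div_mul_left _ _ (Real.rpow_pos_of_pos ht _).ne']

theorem inner_dilation (x y : 𝔼) :
    inner ℝ (M.dilation t ht x) y = inner ℝ x (M.dilation t ht y) := by
  simp only [PiLp.inner_apply, dilation_apply, RCLike.inner_apply, conj_trivial]
  exact Finset.sum_congr rfl fun j _ => by ring

theorem norm_dilation_le (ht1 : t ≤ 1) (x : 𝔼) : ‖M.dilation t ht x‖ ≤ t * ‖x‖ := by
  have hsmul : ‖t • x‖ = t * ‖x‖ := by rw [norm_smul, Real.norm_of_nonneg ht.le]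
  rw [← hsmul, EuclideanSpace.norm_eq, EuclideanSpace.norm_eq]
  gcongr with j
  have hpow : t ^ M.m j ≤ t := by
    simpa using Real.rpow_le_rpow_of_exponent_ge ht ht1 (M.one_le j)
  rw [dilation_apply, PiLp.smul_apply, smul_eq_mul, norm_mul, norm_mul,
    Real.norm_of_nonneg (by positivity), Real.norm_of_nonneg ht.le]
  gcongr

theorem det_dilation :
    LinearMap.det (M.dilation t ht : 𝔼 →ₗ[ℝ] 𝔼) = t ^ M.total := by
  set b := (EuclideanSpace.basisFun (Fin n) ℝ).toBasis
  have h : (M.dilation t ht : 𝔼 →ₗ[ℝ] 𝔼) =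
      Matrix.toLin b b (Matrix.diagonal fun j => t ^ M.m j) := by
    refine b.ext fun i => ?_
    rw [Matrix.toLin_self]
    ext j
    simp only [b, OrthonormalBasis.coe_toBasis, EuclideanSpace.basisFun_apply]
    change M.dilation t ht (EuclideanSpace.single i 1) j = _
    rw [dilation_apply]
    by_cases hij : j = i <;> simp [Matrix.diagonal_apply, hij]
  rw [h, LinearMap.det_toLin, Matrix.det_diagonal, ← Real.rpow_sum_of_pos ht, total]

theorem map_dilation_volume :
    Measure.map (M.dilation t ht) volume =
      ENNReal.ofReal t ^ (-M.total) • (volume : Measure 𝔼) := by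
  have h := Measure.map_linearMap_addHaar_eq_smul_addHaar (volume : Measure 𝔼)
    (f := (M.dilation t ht : 𝔼 →ₗ[ℝ] 𝔼)) (by rw [det_dilation]; positivity)
  rwa [det_dilation, ← Real.rpow_neg ht.le, abs_of_pos (by positivity),
    ← ENNReal.ofReal_rpow_of_pos ht] at h

theorem measurableEmbedding_dilation : MeasurableEmbedding (M.dilation t ht) :=
  (M.dilation t ht).toHomeomorph.measurableEmbedding

theorem eLpNorm_comp_dilation {F : Type*} [TopologicalSpace F] [ContinuousENorm F]
    (p : ℝ≥0∞) (f : 𝔼 → F) :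
    eLpNorm (fun x => f (M.dilation t ht x)) p volume =
      ENNReal.ofReal t ^ (-(M.total * (p⁻¹).toReal)) * eLpNorm f p volume := by
  have h := (M.measurableEmbedding_dilation ht).eLpNorm_map_measure (g := f) (p := p) (μ := volume)
  rw [map_dilation_volume, eLpNorm_smul_measure_of_ne_zero (by simp [ht])] at h
  rw [← Function.comp_def f, ← h, ← ENNReal.rpow_mul, one_div, smul_eq_mul, neg_mul]

theorem integral_comp_dilation {F : Type*} [NormedAddCommGroup F] [NormedSpace ℝ F] (f : 𝔼 → F) :
    ∫ x, f (M.dilation t ht x) = (t ^ (-M.total) : ℝ) • ∫ x, f x := by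
  rw [← (M.measurableEmbedding_dilation ht).integral_map (μ := volume) f, map_dilation_volume,
    integral_smul_measure, ← ENNReal.toReal_rpow, ENNReal.toReal_ofReal ht.le]

end Dilation

/-- The dyadic dilation `x ↦ 2^{kM} x`, by which all frequency annuli are images of one another. -/
def dyadicDilation (k : ℤ) : 𝔼 ≃L[ℝ] 𝔼 :=
  M.dilation ((2 : ℝ) ^ k) (by positivity)

theorem dyadicDilation_add (k l : ℤ) (x : 𝔼) :
    M.dyadicDilation (k + l) x = M.dyadicDilation k (M.dyadicDilation l x) := by
  ext j
  simp only [dyadicDilation, dilation_apply]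
  rw [zpow_add₀ two_ne_zero, Real.mul_rpow (by positivity) (by positivity), mul_assoc]

theorem dyadicDilation_zero (x : 𝔼) : M.dyadicDilation 0 x = x := by
  ext j
  simp [dyadicDilation, dilation_apply]

theorem dyadicDilation_neg_cancel (k : ℤ) (x : 𝔼) :
    M.dyadicDilation (-k) (M.dyadicDilation k x) = x := by
  rw [← dyadicDilation_add, neg_add_cancel, dyadicDilation_zero]

theorem dyadicDilation_cancel_neg (k : ℤ) (x : 𝔼) :
    M.dyadicDilation k (M.dyadicDilation (-k) x) = x := by
  rw [← dyadicDilation_add, add_neg_cancel, dyadicDilation_zero]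

theorem norm_dyadicDilation_le {k : ℤ} (hk : k ≤ 0) (x : 𝔼) :
    ‖M.dyadicDilation k x‖ ≤ 2 ^ k * ‖x‖ :=
  M.norm_dilation_le _ (zpow_le_one_of_nonpos₀ one_le_two hk) x

theorem tendsto_dyadicDilation_neg (x : 𝔼) :
    Tendsto (fun k : ℕ => M.dyadicDilation (-(k : ℤ)) x) atTop (𝓝 0) := by
  refine squeeze_zero_norm (fun k => M.norm_dyadicDilation_le (by omega) x) ?_
  have h := tendsto_inv_atTop_zero.comp (tendsto_pow_atTop_atTop_of_one_lt (one_lt_two (α := ℝ)))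
  simpa [Function.comp_def, zpow_neg] using h.mul_const ‖x‖

theorem eLpNorm_comp_dyadicDilation {F : Type*} [TopologicalSpace F] [ContinuousENorm F]
    (k : ℤ) (p : ℝ≥0∞) (f : 𝔼 → F) :
    eLpNorm (fun x => f (M.dyadicDilation k x)) p volume =
      (2 : ℝ≥0∞) ^ (-(k * M.total * (p⁻¹).toReal)) * eLpNorm f p volume := by
  rw [dyadicDilation, eLpNorm_comp_dilation, ← Real.rpow_intCast,
    ← ENNReal.ofReal_rpow_of_pos two_pos, ENNReal.ofReal_ofNat, ← ENNReal.rpow_mul, mul_neg,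
    mul_assoc]

theorem integral_comp_dyadicDilation {F : Type*} [NormedAddCommGroup F] [NormedSpace ℝ F] (k : ℤ)
    (f : 𝔼 → F) :
    ∫ x, f (M.dyadicDilation k x) = ((2 : ℝ) ^ (-(k * M.total)) : ℝ) • ∫ x, f x := by
  rw [dyadicDilation, integral_comp_dilation, ← Real.rpow_intCast, ← Real.rpow_mul two_pos.le,
    mul_neg]

end AnisotropicWeight

/-! ### Sequence quasi-norms -/

theorem ellNorm_eq_eLpNorm_count {q : ℝ≥0∞} (hq : q ≠ 0) (a : ℕ → ℝ≥0∞) :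
    ellNorm q a = eLpNorm a q Measure.count := by
  rw [ellNorm]
  split_ifs with htop
  · simp [htop]
  · rw [eLpNorm_eq_lintegral_rpow_enorm_toReal hq htop, lintegral_count]
    rfl

theorem le_ellNorm {q : ℝ≥0∞} (hq : q ≠ 0) (a : ℕ → ℝ≥0∞) (j : ℕ) : a j ≤ ellNorm q a := by
  rw [ellNorm_eq_eLpNorm_count hq]
  exact enorm_le_eLpNorm_count a j hq

theorem ellNorm_mono {q : ℝ≥0∞} (hq : q ≠ 0) {a b : ℕ → ℝ≥0∞} (h : ∀ j, a j ≤ b j) :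
    ellNorm q a ≤ ellNorm q b := by
  rw [ellNorm_eq_eLpNorm_count hq, ellNorm_eq_eLpNorm_count hq]
  exact eLpNorm_mono_enorm h

theorem ellNorm_ite_const {q : ℝ≥0∞} (hq : q ≠ 0) {J : Finset ℕ} (hJ : J.Nonempty) (b : ℝ≥0∞) :
    ellNorm q (fun j => if j ∈ J then b else 0) = (J.card : ℝ≥0∞) ^ (q⁻¹).toReal * b := by
  have hind : (fun j => if j ∈ J then b else 0) = (J : Set ℕ).indicator fun _ => b := by
    ext j
    simp [Set.indicator_apply]
  rw [ellNorm_eq_eLpNorm_count hq, hind, eLpNorm_indicator_const' J.measurableSet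
    (by simpa using hJ.ne_empty) hq, Measure.count_apply_finset, mul_comm, one_div,
    ENNReal.toReal_inv, enorm_eq_self]

/-! ### Comparison of growth rates -/

theorem exponent_le_of_tendsto_top {ι : Type*} {l : Filter ι} [l.NeBot] {t : ι → ℝ≥0∞}
    (ht : Tendsto t l (𝓝 ⊤)) (htop : ∀ i, t i ≠ ⊤) {c₁ c₂ : ℝ≥0∞} (h₁ : c₁ ≠ 0) (h₂ : c₂ ≠ ⊤)
    {a b : ℝ} (h : ∀ᶠ i in l, c₁ * t i ^ a ≤ c₂ * t i ^ b) : a ≤ b := by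
  by_contra! hab
  have hlim : Tendsto (fun i => c₁ * t i ^ (a - b)) l (𝓝 ⊤) := by
    have hpow := ((ENNReal.continuous_rpow_const (y := a - b)).tendsto ⊤).comp ht
    rw [ENNReal.top_rpow_of_pos (by linarith)] at hpow
    simpa [ENNReal.mul_top h₁, Function.comp_def] using
      ENNReal.Tendsto.const_mul hpow (a := c₁) (Or.inl (by simp))
  refine h₂ (top_le_iff.mp (le_of_tendsto hlim ?_))
  filter_upwards [h, ht.eventually_const_lt ENNReal.zero_lt_top] with i hi hpos
  calc c₁ * t i ^ (a - b) = c₁ * t i ^ a * t i ^ (-b) := by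
        rw [sub_eq_add_neg, ENNReal.rpow_add _ _ hpos.ne' (htop i), mul_assoc]
    _ ≤ c₂ * t i ^ b * t i ^ (-b) := by gcongr
    _ = c₂ := by
        rw [mul_assoc, ← ENNReal.rpow_add _ _ hpos.ne' (htop i), add_neg_cancel, ENNReal.rpow_zero,
          mul_one]

/-! ### Frequency sets on which a single dyadic multiplier equals one -/

theorem DyadicCutoff.low_eq_one (Ψ : DyadicCutoff) (M : AnisotropicWeight n) {i : ℤ} (hi : 0 ≤ i)
    {ξ : 𝔼} (hξ : M.size ξ ≤ 11 / 10 * 2 ^ i) : Ψ.low M i ξ = 1 := by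
  have hsize := M.size_nonneg ξ
  rw [low, if_pos hi]
  refine Ψ.eq_one _ (by positivity) ?_
  rwa [zpow_neg, inv_mul_le_iff₀ (by positivity), mul_comm]

theorem DyadicCutoff.low_eq_zero (Ψ : DyadicCutoff) (M : AnisotropicWeight n) {i : ℤ} {ξ : 𝔼}
    (hξ : 13 / 10 * 2 ^ i ≤ M.size ξ) : Ψ.low M i ξ = 0 := by
  rw [low, ite_eq_right_iff]
  refine fun _ => Ψ.eq_zero _ ?_
  rwa [zpow_neg, le_inv_mul_iff₀ (by positivity), mul_comm]

namespace AnisotropicWeight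

variable (M : AnisotropicWeight n)

/-- The frequencies seen by `Φ_k` and by no other dyadic multiplier: `Φ_j = δ_{jk}` there. -/
def core (k : ℕ) : Set 𝔼 :=
  {ξ | M.size ξ ≤ 11 / 10 * 2 ^ k ∧ (k ≠ 0 → 13 / 20 * 2 ^ k ≤ M.size ξ)}

theorem dyadic_of_mem_core (Ψ : DyadicCutoff) {k : ℕ} {ξ : 𝔼} (hξ : ξ ∈ M.core k) (j : ℕ) :
    Ψ.dyadic M j ξ = if j = k then 1 else 0 := by
  obtain ⟨hupper, hlower⟩ := hξ
  have one (i : ℤ) (hki : k ≤ i) : Ψ.low M i ξ = 1 := by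
    refine Ψ.low_eq_one M (by omega) (hupper.trans ?_)
    rw [← zpow_natCast]
    gcongr
    exact one_le_two
  have zero (i : ℤ) (hik : i < k) : Ψ.low M i ξ = 0 := by
    by_cases hk : k = 0
    · rw [DyadicCutoff.low, if_neg (by omega)]
    · refine Ψ.low_eq_zero M (le_trans ?_ (hlower hk))
      have hpow : (2 : ℝ) * 2 ^ i ≤ 2 ^ k := by
        rw [← zpow_natCast, ← zpow_one_add₀ two_ne_zero]
        exact zpow_le_zpow_right₀ one_le_two (by omega)
      linarith
  rw [DyadicCutoff.dyadic]
  rcases lt_trichotomy j k with h | h | h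
  · rw [zero _ (by omega), zero _ (by omega), if_neg (by omega), sub_zero]
  · rw [one _ (by omega), zero _ (by omega), if_pos h, sub_zero]
  · rw [one _ (by omega), one _ (by omega), if_neg (by omega), sub_self]

/-- A unit vector in a coordinate direction of weight one, so that `2^{kM}` stretches it by exactly
`2^k`. -/
def unitVector : 𝔼 :=
  EuclideanSpace.single M.exists_eq_one.choose 1

theorem norm_unitVector : ‖M.unitVector‖ = 1 := by
  simp [unitVector]

theorem size_unitVector : M.size M.unitVector = 1 := by
  refine M.size_eq one_pos ?_
  simp [unitVector, PiLp.single_apply, ite_pow]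

theorem dyadicDilation_unitVector (k : ℤ) :
    M.dyadicDilation k M.unitVector = (2 : ℝ) ^ k • M.unitVector := by
  ext j
  rw [dyadicDilation, dilation_apply, PiLp.smul_apply, smul_eq_mul, unitVector, PiLp.single_apply]
  split_ifs with h
  · rw [h, M.exists_eq_one.choose_spec, Real.rpow_one]
  · rw [mul_zero, mul_zero]

theorem exists_radius : ∃ r : ℝ, 0 < r ∧ 3 * r < 1 ∧ ∀ y, ‖y‖ ≤ 3 * r →
    |M.size (M.unitVector + y) - 1| ≤ 1 / 20 := by
  have hne : M.unitVector ≠ 0 := by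
    rw [← norm_pos_iff, norm_unitVector]
    exact one_pos
  obtain ⟨δ, hδ, h⟩ :=
    Metric.continuousAt_iff.mp (M.contDiffAt_size hne).continuousAt (1 / 20) (by norm_num)
  refine ⟨min (δ / 6) (1 / 6), by positivity, ?_, fun y hy => ?_⟩
  · linarith [min_le_right (δ / 6) (1 / 6 : ℝ)]
  · have hdist : dist (M.unitVector + y) M.unitVector < δ := by
      rw [dist_eq_norm, add_sub_cancel_left]
      linarith [min_le_left (δ / 6) (1 / 6 : ℝ)]
    simpa only [size_unitVector, Real.dist_eq] using (h hdist).le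

/-- A radius `r` such that the balls of radius `3r` about `e` and about `0` lie in the cores. The
factor `3` leaves room for the sums of frequencies that occur in products. -/
def radius : ℝ := M.exists_radius.choose

theorem radius_pos : 0 < M.radius := M.exists_radius.choose_spec.1

theorem three_mul_radius_lt_one : 3 * M.radius < 1 := M.exists_radius.choose_spec.2.1

theorem abs_size_unitVector_add_sub_one_le {y : 𝔼} (hy : ‖y‖ ≤ 3 * M.radius) :
    |M.size (M.unitVector + y) - 1| ≤ 1 / 20 :=
  M.exists_radius.choose_spec.2.2 y hy

/-- The anisotropic ball `2^{kM}(σe + B_r)`, where `e` is the vector `unitVector`. -/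
def patch (σ : ℝ) (k : ℤ) (r : ℝ) : Set 𝔼 :=
  {ξ | ∃ y, ‖y‖ ≤ r ∧ ξ = M.dyadicDilation k (σ • M.unitVector + y)}

theorem patch_mono {σ : ℝ} {k : ℤ} {r r' : ℝ} (h : r ≤ r') : M.patch σ k r ⊆ M.patch σ k r' :=
  fun _ ⟨y, hy, hξ⟩ => ⟨y, hy.trans h, hξ⟩

theorem mem_patch_zero_zero {r : ℝ} {ξ : 𝔼} : ξ ∈ M.patch 0 0 r ↔ ‖ξ‖ ≤ r := by
  simp [patch, dyadicDilation_zero]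

theorem patch_subset_core {σ : ℝ} (hσ : |σ| = 1) (k : ℕ) :
    M.patch σ k (3 * M.radius) ⊆ M.core k := by
  rintro _ ⟨y, hy, rfl⟩
  have hsize : |M.size (σ • M.unitVector + y) - 1| ≤ 1 / 20 := by
    rcases eq_or_eq_neg_of_abs_eq hσ with rfl | rfl
    · rw [one_smul]
      exact M.abs_size_unitVector_add_sub_one_le hy
    · rw [← M.size_neg, neg_add, neg_smul, neg_neg, one_smul]
      exact M.abs_size_unitVector_add_sub_one_le (by rwa [norm_neg])
  rw [abs_le] at hsize
  have hpow : (0 : ℝ) < 2 ^ k := by positivity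
  rw [core, Set.mem_ofPred_eq, dyadicDilation, size_dilation, zpow_natCast]
  exact ⟨by nlinarith, fun _ => by nlinarith⟩

theorem patch_zero_subset_core {k : ℤ} (hk : k ≤ 0) :
    M.patch 0 k (3 * M.radius) ⊆ M.core 0 := by
  rintro _ ⟨y, hy, rfl⟩
  rw [zero_smul, zero_add]
  have hnorm : ‖M.dyadicDilation k y‖ < 1 :=
    calc ‖M.dyadicDilation k y‖ ≤ 2 ^ k * ‖y‖ := M.norm_dyadicDilation_le hk y
      _ ≤ 1 * ‖y‖ := by
        gcongr
        exact zpow_le_one_of_nonpos₀ one_le_two hk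
      _ < 1 := by linarith [M.three_mul_radius_lt_one]
  refine ⟨(M.size_le_one hnorm).trans ?_, fun h => absurd rfl h⟩
  norm_num

theorem patch_two_subset (k : ℤ) {r : ℝ} : M.patch 2 k r ⊆ M.patch 1 (k + 1) r := by
  rintro _ ⟨y, hy, rfl⟩
  refine ⟨M.dyadicDilation (-1) y, (M.norm_dyadicDilation_le (by norm_num) y).trans ?_, ?_⟩
  · norm_num
    linarith [norm_nonneg y]
  · rw [dyadicDilation_add, map_add (M.dyadicDilation 1), M.dyadicDilation_cancel_neg 1, one_smul,
      dyadicDilation_unitVector, zpow_one]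

open Pointwise in
theorem patch_add_patch_subset {σ τ : ℝ} {k : ℤ} {r r' : ℝ} :
    M.patch σ k r + M.patch τ k r' ⊆ M.patch (σ + τ) k (r + r') := by
  rintro _ ⟨_, ⟨y, hy, rfl⟩, _, ⟨z, hz, rfl⟩, rfl⟩
  refine ⟨y + z, (norm_add_le _ _).trans (add_le_add hy hz), ?_⟩
  simp only [map_add, map_smul, add_smul]
  abel

open Pointwise in
theorem patch_add_low_patch_subset {σ : ℝ} {k : ℤ} (hk : 0 ≤ k) {r r' : ℝ} :
    M.patch σ k r + M.patch 0 0 r' ⊆ M.patch σ k (r + r') := by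
  rintro _ ⟨_, ⟨y, hy, rfl⟩, z, hz, rfl⟩
  rw [mem_patch_zero_zero] at hz
  have hz' : ‖M.dyadicDilation (-k) z‖ ≤ r' :=
    (M.norm_dyadicDilation_le (by omega) z).trans ((mul_le_of_le_one_left (norm_nonneg z)
      (zpow_le_one_of_nonpos₀ one_le_two (by omega))).trans hz)
  refine ⟨y + M.dyadicDilation (-k) z, (norm_add_le _ _).trans (add_le_add hy hz'), ?_⟩
  rw [← add_assoc, map_add _ (σ • M.unitVector + y), M.dyadicDilation_cancel_neg]

theorem exists_gap : ∃ L : ℕ, 2 ≤ M.radius * 2 ^ L := by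
  obtain ⟨L, hL⟩ := pow_unbounded_of_one_lt (2 / M.radius) (one_lt_two (α := ℝ))
  rw [div_lt_iff₀' M.radius_pos] at hL
  exact ⟨L, hL.le⟩

/-- A distance between dyadic levels beyond which the lower frequency is negligible in the sum of
two frequencies. -/
def gap : ℕ := M.exists_gap.choose

theorem two_le_radius_mul_two_pow_gap : 2 ≤ M.radius * 2 ^ M.gap := M.exists_gap.choose_spec

theorem gap_ne_zero : M.gap ≠ 0 := by
  intro h
  have := M.two_le_radius_mul_two_pow_gap
  rw [h, pow_zero] at this
  linarith [M.three_mul_radius_lt_one, M.radius_pos]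

open Pointwise in
theorem patch_add_far_patch_subset {σ τ : ℝ} (hτ : |τ| ≤ 1) {k l : ℤ} (hkl : l + M.gap ≤ k) :
    M.patch σ k M.radius + M.patch τ l M.radius ⊆ M.patch σ k (3 * M.radius) := by
  rintro _ ⟨_, ⟨y, hy, rfl⟩, _, ⟨z, hz, rfl⟩, rfl⟩
  have hτz : ‖τ • M.unitVector + z‖ ≤ 2 := by
    refine (norm_add_le _ _).trans ?_
    rw [norm_smul, norm_unitVector, mul_one, Real.norm_eq_abs]
    linarith [M.three_mul_radius_lt_one, M.radius_pos]
  have hdil : ‖M.dyadicDilation (l - k) (τ • M.unitVector + z)‖ ≤ M.radius :=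
    calc ‖M.dyadicDilation (l - k) (τ • M.unitVector + z)‖
        ≤ 2 ^ (l - k) * ‖τ • M.unitVector + z‖ := M.norm_dyadicDilation_le (by omega) _
      _ ≤ 2 ^ (-(M.gap : ℤ)) * 2 := by
        gcongr
        · exact one_le_two
        · omega
      _ ≤ M.radius := by
        rw [zpow_neg, zpow_natCast, inv_mul_le_iff₀ (by positivity), mul_comm]
        exact M.two_le_radius_mul_two_pow_gap
  refine ⟨y + M.dyadicDilation (l - k) (τ • M.unitVector + z),
    (norm_add_le _ _).trans (by linarith [M.radius_pos]), ?_⟩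
  simp only [← add_assoc]
  rw [map_add _ (σ • M.unitVector + y), ← dyadicDilation_add, add_sub_cancel]

end AnisotropicWeight

/-! ### Lacunary sets of dyadic levels -/

/-- Any two distinct elements of `J` differ by at least `L`: the lacunary sets of levels over which
the test functions are summed. -/
def Sparse (L : ℕ) (J : Finset ℕ) : Prop :=
  (J : Set ℕ).Pairwise fun k l => k + L ≤ l ∨ l + L ≤ k

theorem exists_sparse {L : ℕ} (hL : L ≠ 0) (K N : ℕ) :
    ∃ J : Finset ℕ, J.card = N ∧ Sparse L J ∧ ∀ k ∈ J, K ≤ k := by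
  have hinj : Function.Injective fun i : ℕ => K + L * i := fun a b h => by
    simpa [hL] using h
  refine ⟨(Finset.range N).image fun i => K + L * i, ?_, ?_, ?_⟩
  · rw [Finset.card_image_of_injective _ hinj, Finset.card_range]
  · rw [Sparse, Finset.coe_image]
    refine Set.Pairwise.image fun i _ j _ hij => ?_
    rcases hij.lt_or_gt with h | h
    · exact Or.inl (by linarith [Nat.mul_le_mul_left L (Nat.succ_le_of_lt h)])
    · exact Or.inr (by linarith [Nat.mul_le_mul_left L (Nat.succ_le_of_lt h)])
  · simp

/-! ### Spectra of Schwartz functions -/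

section Spectrum

/-- The set `S` contains every frequency `ξ` with `f̂(ξ) = ∫ e^{-i x·ξ} f(x) dx ≠ 0`. Mathlib's
transform is `𝓕 f η = f̂(2πη)`, which accounts for the scaling. -/
def SpectrumIn (f : 𝓢(𝔼, ℂ)) (S : Set 𝔼) : Prop :=
  ∀ η, 𝓕 f η ≠ 0 → (2 * Real.pi) • η ∈ S

theorem SpectrumIn.mono {f : 𝓢(𝔼, ℂ)} {S T : Set 𝔼} (h : SpectrumIn f S) (hST : S ⊆ T) :
    SpectrumIn f T :=
  fun η hη => hST (h η hη)

theorem SpectrumIn.const_smul {f : 𝓢(𝔼, ℂ)} {S : Set 𝔼} (h : SpectrumIn f S) (c : ℂ) :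
    SpectrumIn (c • f) S := by
  refine fun η hη => h η fun h0 => hη ?_
  rw [FourierTransform.fourier_smul, _root_.smul_apply, h0, smul_zero]

theorem SpectrumIn.sum {ι : Type*} {J : Finset ι} {f : ι → 𝓢(𝔼, ℂ)} {S : Set 𝔼}
    (h : ∀ i ∈ J, SpectrumIn (f i) S) : SpectrumIn (∑ i ∈ J, f i) S := by
  intro η hη
  rw [FourierTransform.fourier_sum, _root_.sum_apply] at hη
  obtain ⟨i, hi, h0⟩ := Finset.exists_ne_zero_of_sum_ne_zero hη
  exact h i hi η h0

/-- The symbol `η ↦ χ(2πη)`: the Fourier multiplier `χ(ξ)` in the normalisation of Mathlib. -/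
def scaledSymbol (χ : 𝓢(𝔼, ℂ)) : 𝓢(𝔼, ℂ) :=
  SchwartzMap.compCLMOfContinuousLinearEquiv ℂ (twoPiScaling n) χ

theorem scaledSymbol_apply (χ : 𝓢(𝔼, ℂ)) (η : 𝔼) : scaledSymbol χ η = χ ((2 * Real.pi) • η) := rfl

theorem bandPart_coe (χ f : 𝓢(𝔼, ℂ)) :
    bandPart χ f = 𝓕⁻ (schwartzMul (scaledSymbol χ) (𝓕 f)) := by
  ext x
  rw [SchwartzMap.fourierInv_coe, Real.fourierInv_eq']
  simp only [bandPart, TemperedDistribution.fourier_toTemperedDistributionCLM_eq,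
    SchwartzMap.coe_apply, waveTest_apply, schwartzMul_apply, scaledSymbol_apply, smul_eq_mul]
  congr with η
  rw [real_inner_comm x η, mul_assoc]
  push_cast
  ring_nf

theorem bandPart_eq_self {χ f : 𝓢(𝔼, ℂ)} {S : Set 𝔼} (hf : SpectrumIn f S)
    (hχ : ∀ ξ ∈ S, χ ξ = 1) : bandPart χ f = f := by
  have h : schwartzMul (scaledSymbol χ) (𝓕 f) = 𝓕 f := by
    ext η
    by_cases hη : 𝓕 f η = 0
    · rw [schwartzMul_apply, hη, mul_zero]
    · rw [schwartzMul_apply, scaledSymbol_apply, hχ _ (hf η hη), one_mul]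
  rw [bandPart_coe, h, FourierTransform.fourierInv_fourier_eq]

theorem bandPart_eq_zero {χ f : 𝓢(𝔼, ℂ)} {S : Set 𝔼} (hf : SpectrumIn f S)
    (hχ : ∀ ξ ∈ S, χ ξ = 0) : bandPart χ f = 0 := by
  have h : schwartzMul (scaledSymbol χ) (𝓕 f) = 0 := by
    ext η
    by_cases hη : 𝓕 f η = 0
    · rw [schwartzMul_apply, hη, mul_zero, _root_.zero_apply]
    · rw [schwartzMul_apply, scaledSymbol_apply, hχ _ (hf η hη), zero_mul, _root_.zero_apply]
  rw [bandPart_coe, h, FourierTransform.fourierInv_zero]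
  rfl

theorem bandPart_sum {ι : Type*} (χ : 𝓢(𝔼, ℂ)) (f : ι → 𝓢(𝔼, ℂ)) (J : Finset ι) (x : 𝔼) :
    bandPart χ (∑ i ∈ J, f i : 𝓢(𝔼, ℂ)) x = ∑ i ∈ J, bandPart χ (f i) x := by
  simp only [bandPart, TemperedDistribution.fourier_toTemperedDistributionCLM_eq,
    FourierTransform.fourier_sum, map_sum, _root_.sum_apply]

theorem bandPart_smul (χ f : 𝓢(𝔼, ℂ)) (c : ℂ) (x : 𝔼) :
    bandPart χ (c • f : 𝓢(𝔼, ℂ)) x = c * bandPart χ f x := by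
  simp only [bandPart, TemperedDistribution.fourier_toTemperedDistributionCLM_eq,
    FourierTransform.fourier_smul, map_smul, _root_.smul_apply, smul_eq_mul]

/-- The modulation `x ↦ e^{i x·ξ} f(x)`, which translates the spectrum of `f` by `ξ`. -/
def waveMul (ξ : 𝔼) (f : 𝓢(𝔼, ℂ)) : 𝓢(𝔼, ℂ) :=
  SchwartzMap.smulLeftCLM ℂ (fun x => Complex.exp (2 * Real.pi * Complex.I *
    (inner ℝ ((2 * Real.pi)⁻¹ • ξ) x : ℝ))) f

theorem waveMul_apply (ξ x : 𝔼) (f : 𝓢(𝔼, ℂ)) :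
    waveMul ξ f x = Complex.exp ((inner ℝ ξ x : ℝ) * Complex.I) * f x := by
  rw [waveMul, SchwartzMap.smulLeftCLM_apply_apply (planeWave_hasTemperateGrowth _), smul_eq_mul,
    real_inner_smul_left]
  have := Complex.ofReal_ne_zero.mpr Real.pi_pos.ne'
  congr 2
  push_cast
  field_simp

theorem enorm_waveMul_apply (ξ x : 𝔼) (f : 𝓢(𝔼, ℂ)) : ‖waveMul ξ f x‖ₑ = ‖f x‖ₑ := by
  rw [← ofReal_norm, waveMul_apply, norm_mul, Complex.norm_exp_ofReal_mul_I, one_mul, ofReal_norm]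

theorem waveMul_zero (f : 𝓢(𝔼, ℂ)) : waveMul 0 f = f := by
  ext x
  simp [waveMul_apply]

theorem schwartzMul_waveMul (ξ ζ : 𝔼) (f g : 𝓢(𝔼, ℂ)) :
    schwartzMul (waveMul ξ f) (waveMul ζ g) = waveMul (ξ + ζ) (schwartzMul f g) := by
  ext x
  simp only [schwartzMul_apply, waveMul_apply, inner_add_left, Complex.ofReal_add, add_mul,
    Complex.exp_add]
  ring

theorem fourier_waveMul (ξ η : 𝔼) (f : 𝓢(𝔼, ℂ)) :
    𝓕 (waveMul ξ f) η = 𝓕 f (η - (2 * Real.pi)⁻¹ • ξ) := by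
  rw [SchwartzMap.fourier_coe, SchwartzMap.fourier_coe, Real.fourier_eq', Real.fourier_eq']
  congr with x
  have := Complex.ofReal_ne_zero.mpr Real.pi_pos.ne'
  simp only [smul_eq_mul, waveMul_apply]
  rw [← mul_assoc, ← Complex.exp_add, inner_sub_right, inner_smul_right, real_inner_comm x ξ]
  congr 2
  push_cast
  field_simp
  ring

theorem SpectrumIn.waveMul {f : 𝓢(𝔼, ℂ)} {S T : Set 𝔼} (hf : SpectrumIn f S) (ξ : 𝔼)
    (hT : ∀ ζ ∈ S, ξ + ζ ∈ T) : SpectrumIn (waveMul ξ f) T := by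
  intro η hη
  rw [fourier_waveMul] at hη
  simpa only [smul_sub, smul_inv_smul₀ Real.two_pi_pos.ne', add_sub_cancel] using hT _ (hf _ hη)

/-- The multiplication formula `∫ û v = ∫ u v̂`, applied to `u = 𝓕⁻¹ f` and a modulation of `g`. -/
theorem fourier_schwartzMul (f g : 𝓢(𝔼, ℂ)) (ζ : 𝔼) :
    𝓕 (schwartzMul f g) ζ = ∫ η, 𝓕 f (-η) * 𝓕 g (η + ζ) := by
  have hswap := SchwartzMap.integral_fourier_mul_eq (𝓕⁻ f) (waveMul (-((2 * Real.pi) • ζ)) g)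
  have hinv (η : 𝔼) : (𝓕⁻ f) η = 𝓕 f (-η) := by
    rw [SchwartzMap.fourierInv_coe, SchwartzMap.fourier_coe, Real.fourierInv_eq_fourier_neg]
  simp only [FourierTransform.fourier_fourierInv_eq, fourier_waveMul, hinv, smul_neg,
    inv_smul_smul₀ Real.two_pi_pos.ne', sub_neg_eq_add] at hswap
  rw [← hswap, SchwartzMap.fourier_coe, Real.fourier_eq']
  congr with x
  simp only [smul_eq_mul, waveMul_apply, schwartzMul_apply, inner_neg_left, real_inner_smul_left]
  rw [mul_left_comm, real_inner_comm x ζ]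
  congr 3
  push_cast
  ring

open Pointwise in
theorem SpectrumIn.schwartzMul {f g : 𝓢(𝔼, ℂ)} {S T : Set 𝔼} (hf : SpectrumIn f S)
    (hg : SpectrumIn g T) : SpectrumIn (schwartzMul f g) (S + T) := by
  intro ζ hζ
  rw [fourier_schwartzMul] at hζ
  obtain ⟨η, hη⟩ : ∃ η, 𝓕 f (-η) * 𝓕 g (η + ζ) ≠ 0 := by
    by_contra! h
    exact hζ (by simp [h])
  obtain ⟨hfη, hgη⟩ := mul_ne_zero_iff.mp hη
  refine ⟨_, hf _ hfη, _, hg _ hgη, ?_⟩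
  simp only [← smul_add, neg_add_cancel_left]

variable (M : AnisotropicWeight n)

/-- The dilated function `x ↦ f(2^{kM} x)`. -/
def dilate (k : ℤ) (f : 𝓢(𝔼, ℂ)) : 𝓢(𝔼, ℂ) :=
  SchwartzMap.compCLMOfContinuousLinearEquiv ℂ (M.dyadicDilation k) f

theorem dilate_apply (k : ℤ) (f : 𝓢(𝔼, ℂ)) (x : 𝔼) :
    dilate M k f x = f (M.dyadicDilation k x) := rfl

theorem schwartzMul_dilate (k : ℤ) (f g : 𝓢(𝔼, ℂ)) :
    schwartzMul (dilate M k f) (dilate M k g) = dilate M k (schwartzMul f g) := rfl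

theorem fourier_dilate (k : ℤ) (f : 𝓢(𝔼, ℂ)) (η : 𝔼) :
    𝓕 (dilate M k f) η =
      ((2 : ℝ) ^ (-(k * M.total)) : ℝ) * 𝓕 f (M.dyadicDilation (-k) η) := by
  rw [SchwartzMap.fourier_coe, SchwartzMap.fourier_coe, Real.fourier_eq', Real.fourier_eq',
    ← Complex.real_smul, ← M.integral_comp_dyadicDilation]
  congr with x
  rw [dilate_apply, AnisotropicWeight.dyadicDilation, M.inner_dilation,
    ← AnisotropicWeight.dyadicDilation, M.dyadicDilation_cancel_neg]

theorem SpectrumIn.dilate {f : 𝓢(𝔼, ℂ)} {S T : Set 𝔼} (hf : SpectrumIn f S) (k : ℤ)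
    (hT : ∀ ζ ∈ S, M.dyadicDilation k ζ ∈ T) : SpectrumIn (dilate M k f) T := by
  intro η hη
  rw [fourier_dilate] at hη
  simpa only [map_smul, M.dyadicDilation_cancel_neg] using hT _ (hf _ (right_ne_zero_of_mul hη))

end Spectrum

/-! ### Norms of sums of spectrally separated blocks -/

theorem two_rpow_mul (a b : ℝ) : (2 : ℝ≥0∞) ^ a * 2 ^ b = 2 ^ (a + b) :=
  (ENNReal.rpow_add _ _ (by norm_num) (by norm_num)).symm

theorem two_rpow_ne_top (a : ℝ) : (2 : ℝ≥0∞) ^ a ≠ ⊤ :=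
  ENNReal.rpow_ne_top_of_ne_zero (by norm_num) (by norm_num)

theorem two_rpow_ne_zero (a : ℝ) : (2 : ℝ≥0∞) ^ a ≠ 0 :=
  (ENNReal.rpow_pos (by norm_num) (by norm_num)).ne'

theorem eLpNorm_const_mul_enorm {α F : Type*} [MeasurableSpace α] [NormedAddCommGroup F]
    [NormedSpace ℝ F] {c : ℝ≥0∞} (hc : c ≠ ⊤) (f : α → F) (p : ℝ≥0∞) (μ : Measure α) :
    eLpNorm (fun x => c * ‖f x‖ₑ) p μ = c * eLpNorm f p μ := by
  have h : ‖c.toReal‖ₑ = c := by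
    rw [Real.enorm_of_nonneg ENNReal.toReal_nonneg, ENNReal.ofReal_toReal hc]
  rw [← congrArg (· * eLpNorm f p μ) h, ← eLpNorm_const_smul]
  refine eLpNorm_congr_enorm_ae (.of_forall fun x => ?_)
  rw [enorm_eq_self, Pi.smul_apply, enorm_smul, h]

section Norms

variable (M : AnisotropicWeight n) (Ψ : DyadicCutoff)

theorem spaceNorm_of_besov {A : SpaceParams} (hA : A.scale = Scale.B) (u : 𝓢'(𝔼, ℂ)) :
    spaceNorm M Ψ A u = ellNorm A.q fun j =>
      (2 : ℝ≥0∞) ^ (A.s * j) * eLpNorm (bandPart (Ψ.dyadicSchwartz M j) u) A.p volume := by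
  simp only [spaceNorm, hA]

theorem spaceNorm_of_triebel {A : SpaceParams} (hA : A.scale = Scale.F) (u : 𝓢'(𝔼, ℂ)) :
    spaceNorm M Ψ A u = eLpNorm (fun x => ellNorm A.q fun j =>
      (2 : ℝ≥0∞) ^ (A.s * j) * ‖bandPart (Ψ.dyadicSchwartz M j) u x‖ₑ) A.p volume := by
  simp only [spaceNorm, hA]

theorem le_spaceNorm (A : SpaceParams) (u : 𝓢'(𝔼, ℂ)) (j : ℕ) :
    (2 : ℝ≥0∞) ^ (A.s * j) * eLpNorm (bandPart (Ψ.dyadicSchwartz M j) u) A.p volume ≤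
      spaceNorm M Ψ A u := by
  cases hA : A.scale
  · rw [spaceNorm_of_besov M Ψ hA]
    exact le_ellNorm A.q_pos.ne' (fun j : ℕ => (2 : ℝ≥0∞) ^ (A.s * j) *
      eLpNorm (bandPart (Ψ.dyadicSchwartz M j) u) A.p volume) j
  · rw [spaceNorm_of_triebel M Ψ hA, ← eLpNorm_const_mul_enorm (two_rpow_ne_top _)]
    refine eLpNorm_mono_enorm fun x => ?_
    rw [enorm_eq_self, enorm_eq_self]
    exact le_ellNorm A.q_pos.ne' (fun j : ℕ => (2 : ℝ≥0∞) ^ (A.s * j) *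
      ‖bandPart (Ψ.dyadicSchwartz M j) u x‖ₑ) j

theorem le_spaceNorm_of_besov {A : SpaceParams} (hA : A.scale = Scale.B) {u : 𝓢'(𝔼, ℂ)}
    {J : Finset ℕ} (hJ : J.Nonempty) {b : ℝ≥0∞} (h : ∀ j ∈ J, b ≤
      (2 : ℝ≥0∞) ^ (A.s * j) * eLpNorm (bandPart (Ψ.dyadicSchwartz M j) u) A.p volume) :
    (J.card : ℝ≥0∞) ^ (A.q⁻¹).toReal * b ≤ spaceNorm M Ψ A u := by
  rw [spaceNorm_of_besov M Ψ hA, ← ellNorm_ite_const A.q_pos.ne' hJ]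
  refine ellNorm_mono A.q_pos.ne' fun j => ?_
  split_ifs with hj
  · exact h j hj
  · exact zero_le

theorem bandPart_of_core {f : 𝓢(𝔼, ℂ)} {k : ℕ} (hf : SpectrumIn f (M.core k)) (j : ℕ) (x : 𝔼) :
    bandPart (Ψ.dyadicSchwartz M j) f x = if j = k then f x else 0 := by
  have hΦ : ∀ ξ ∈ M.core k, Ψ.dyadicSchwartz M j ξ = if j = k then 1 else 0 :=
    fun ξ hξ => M.dyadic_of_mem_core Ψ hξ j
  split_ifs with h
  · rw [bandPart_eq_self hf fun ξ hξ => (hΦ ξ hξ).trans (if_pos h)]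
  · rw [bandPart_eq_zero hf fun ξ hξ => (hΦ ξ hξ).trans (if_neg h), Pi.zero_apply]

theorem bandPart_sum_core {f : ℕ → 𝓢(𝔼, ℂ)} {J : Finset ℕ}
    (hf : ∀ k ∈ J, SpectrumIn (f k) (M.core k)) (j : ℕ) (x : 𝔼) :
    bandPart (Ψ.dyadicSchwartz M j) (∑ k ∈ J, f k : 𝓢(𝔼, ℂ)) x = if j ∈ J then f j x else 0 := by
  rw [bandPart_sum, Finset.sum_congr rfl fun k hk => bandPart_of_core M Ψ (hf k hk) j x,
    Finset.sum_ite_eq]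

theorem spaceNorm_sum_besov {A : SpaceParams} (hA : A.scale = Scale.B) {f : ℕ → 𝓢(𝔼, ℂ)}
    {J : Finset ℕ} (hJ : J.Nonempty) (hf : ∀ k ∈ J, SpectrumIn (f k) (M.core k)) {b : ℝ≥0∞}
    (hb : ∀ k ∈ J, (2 : ℝ≥0∞) ^ (A.s * k) * eLpNorm (f k) A.p volume = b) :
    spaceNorm M Ψ A (∑ k ∈ J, f k : 𝓢(𝔼, ℂ)) = (J.card : ℝ≥0∞) ^ (A.q⁻¹).toReal * b := by
  rw [spaceNorm_of_besov M Ψ hA, ← ellNorm_ite_const A.q_pos.ne' hJ]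
  congr 1
  ext j
  rw [funext (bandPart_sum_core M Ψ hf j)]
  by_cases hj : j ∈ J
  · simp only [if_pos hj, ← hb j hj]
  · simp [if_neg hj]

theorem spaceNorm_sum_eq (A : SpaceParams) {f : ℕ → 𝓢(𝔼, ℂ)} {J : Finset ℕ} (hJ : J.Nonempty)
    (hf : ∀ k ∈ J, SpectrumIn (f k) (M.core k)) {c : ℝ≥0∞} (hc : c ≠ ⊤) {h : 𝓢(𝔼, ℂ)}
    (hb : ∀ k ∈ J, ∀ x, (2 : ℝ≥0∞) ^ (A.s * k) * ‖f k x‖ₑ = c * ‖h x‖ₑ) :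
    spaceNorm M Ψ A (∑ k ∈ J, f k : 𝓢(𝔼, ℂ)) =
      (J.card : ℝ≥0∞) ^ (A.q⁻¹).toReal * (c * eLpNorm h A.p volume) := by
  cases hA : A.scale
  · refine spaceNorm_sum_besov M Ψ hA hJ hf fun k hk => ?_
    rw [← eLpNorm_const_mul_enorm (two_rpow_ne_top _), funext (hb k hk),
      eLpNorm_const_mul_enorm hc]
  · have hcard : (J.card : ℝ≥0∞) ^ (A.q⁻¹).toReal ≠ ⊤ :=
      ENNReal.rpow_ne_top_of_nonneg ENNReal.toReal_nonneg (by simp)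
    rw [spaceNorm_of_triebel M Ψ hA, ← mul_assoc,
      ← eLpNorm_const_mul_enorm (ENNReal.mul_ne_top hcard hc)]
    congr 1
    ext x
    rw [mul_assoc, ← ellNorm_ite_const A.q_pos.ne' hJ]
    congr 1
    ext j
    rw [bandPart_sum_core M Ψ hf]
    by_cases hj : j ∈ J
    · simp only [if_pos hj, hb j hj]
    · simp [if_neg hj]

theorem spaceNorm_of_core (A : SpaceParams) {f : 𝓢(𝔼, ℂ)} {k : ℕ} (hf : SpectrumIn f (M.core k)) :
    spaceNorm M Ψ A f = (2 : ℝ≥0∞) ^ (A.s * k) * eLpNorm f A.p volume := by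
  simpa using spaceNorm_sum_eq M Ψ A (f := fun _ => f) (Finset.singleton_nonempty k)
    (by simpa using hf) (two_rpow_ne_top (A.s * k)) (h := f) (by simp)

/-! ### Modulated and dilated blocks -/

/-- The factor `2^{-sk}`, the weight of the `k`-th block of a lacunary sum of smoothness `s`. -/
def weightFactor (s : ℝ) (k : ℕ) : ℂ := ((2 : ℝ) ^ (-(s * k)) : ℝ)

theorem enorm_weightFactor (s : ℝ) (k : ℕ) : ‖weightFactor s k‖ₑ = (2 : ℝ≥0∞) ^ (-(s * k)) := by
  rw [weightFactor, ← ofReal_norm, Complex.norm_real, Real.norm_of_nonneg (by positivity),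
    ← ENNReal.ofReal_rpow_of_pos (by norm_num), ENNReal.ofReal_ofNat]

theorem weightFactor_mul (s t : ℝ) (k : ℕ) :
    weightFactor s k * weightFactor t k = weightFactor (s + t) k := by
  rw [weightFactor, weightFactor, weightFactor, ← Complex.ofReal_mul,
    ← Real.rpow_add (by norm_num), ← neg_add, ← add_mul]

theorem weightFactor_zero (k : ℕ) : weightFactor 0 k = 1 := by simp [weightFactor]

/-- The modulation `x ↦ e^{iσ2^k e·x} f(x)` in the direction `e` of weight `1`. -/
def modBlock (σ : ℝ) (f : 𝓢(𝔼, ℂ)) (k : ℕ) : 𝓢(𝔼, ℂ) :=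
  waveMul ((σ * 2 ^ k) • M.unitVector) f

/-- The modulated function `x ↦ e^{iσe·x} f(x)`, dilated by `2^{kM}`. -/
def dilBlock (σ : ℝ) (f : 𝓢(𝔼, ℂ)) (k : ℕ) : 𝓢(𝔼, ℂ) :=
  dilate M k (waveMul (σ • M.unitVector) f)

theorem spectrumIn_modBlock {σ r : ℝ} {f : 𝓢(𝔼, ℂ)} (hf : SpectrumIn f (M.patch 0 0 r)) (k : ℕ) :
    SpectrumIn (modBlock M σ f k) (M.patch σ k r) := by
  refine hf.waveMul _ fun ζ hζ => ?_
  rw [← zero_add r]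
  refine M.patch_add_low_patch_subset (k := k) (by omega) ⟨_, ⟨0, by simp, ?_⟩, _, hζ, rfl⟩
  rw [add_zero, map_smul, M.dyadicDilation_unitVector, smul_smul, zpow_natCast]

theorem spectrumIn_dilBlock {σ r : ℝ} {f : 𝓢(𝔼, ℂ)} (hf : SpectrumIn f (M.patch 0 0 r)) (k : ℕ) :
    SpectrumIn (dilBlock M σ f k) (M.patch σ k r) :=
  (hf.waveMul (T := {ξ | M.dyadicDilation k ξ ∈ M.patch σ k r}) _ fun y hy =>
    ⟨y, M.mem_patch_zero_zero.mp hy, rfl⟩).dilate M k fun _ hζ => hζ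

theorem enorm_modBlock (σ : ℝ) (f : 𝓢(𝔼, ℂ)) (k : ℕ) (x : 𝔼) : ‖modBlock M σ f k x‖ₑ = ‖f x‖ₑ :=
  enorm_waveMul_apply _ _ _

theorem enorm_dilBlock (σ : ℝ) (f : 𝓢(𝔼, ℂ)) (k : ℕ) (x : 𝔼) :
    ‖dilBlock M σ f k x‖ₑ = ‖f (M.dyadicDilation k x)‖ₑ :=
  enorm_waveMul_apply _ _ _

theorem eLpNorm_dilate (k : ℤ) (f : 𝓢(𝔼, ℂ)) (p : ℝ≥0∞) :
    eLpNorm (dilate M k f) p volume =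
      (2 : ℝ≥0∞) ^ (-(k * M.total * (p⁻¹).toReal)) * eLpNorm f p volume :=
  M.eLpNorm_comp_dyadicDilation k p f

theorem eLpNorm_dilBlock (σ : ℝ) (f : 𝓢(𝔼, ℂ)) (k : ℕ) (p : ℝ≥0∞) :
    eLpNorm (dilBlock M σ f k) p volume =
      (2 : ℝ≥0∞) ^ (-(k * M.total * (p⁻¹).toReal)) * eLpNorm f p volume := by
  rw [dilBlock, eLpNorm_dilate, Int.cast_natCast]
  congr 1
  exact eLpNorm_congr_enorm_ae (.of_forall fun x => enorm_waveMul_apply _ _ _)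

/-- The weighted sum of blocks `∑_{k ∈ J} 2^{-sk} f_k`. -/
def blockSum (s : ℝ) (J : Finset ℕ) (f : ℕ → 𝓢(𝔼, ℂ)) : 𝓢(𝔼, ℂ) :=
  ∑ k ∈ J, weightFactor s k • f k

theorem schwartzMul_comm (f g : 𝓢(𝔼, ℂ)) : schwartzMul f g = schwartzMul g f := by
  ext x
  simp only [schwartzMul_apply, mul_comm]

theorem schwartzMul_smul (a b : ℂ) (f g : 𝓢(𝔼, ℂ)) :
    schwartzMul (a • f) (b • g) = (a * b) • schwartzMul f g := by
  ext x
  simp only [schwartzMul_apply, smul_apply, smul_eq_mul]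
  ring

theorem schwartzMul_blockSum_left (s : ℝ) (J : Finset ℕ) (f : ℕ → 𝓢(𝔼, ℂ)) (g : 𝓢(𝔼, ℂ)) :
    schwartzMul (blockSum s J f) g = blockSum s J fun k => schwartzMul (f k) g := by
  ext x
  simp only [schwartzMul_apply, blockSum, sum_apply, smul_apply, smul_eq_mul, Finset.sum_mul,
    mul_assoc]

theorem schwartzMul_blockSum_blockSum (s t : ℝ) (J : Finset ℕ) (f g : ℕ → 𝓢(𝔼, ℂ)) :
    schwartzMul (blockSum s J f) (blockSum t J g) =
      ∑ kl ∈ J ×ˢ J,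
        (weightFactor s kl.1 * weightFactor t kl.2) • schwartzMul (f kl.1) (g kl.2) := by
  ext x
  simp only [schwartzMul_apply, blockSum, sum_apply, smul_apply, smul_eq_mul, Finset.sum_mul_sum,
    Finset.sum_product, mul_mul_mul_comm]

theorem spaceNorm_modSum (A : SpaceParams) {σ : ℝ} (hσ : |σ| = 1) {J : Finset ℕ}
    (hJ : J.Nonempty) {f : 𝓢(𝔼, ℂ)} (hf : SpectrumIn f (M.patch 0 0 (3 * M.radius))) :
    spaceNorm M Ψ A (blockSum A.s J (modBlock M σ f)) =
      (J.card : ℝ≥0∞) ^ (A.q⁻¹).toReal * eLpNorm f A.p volume := by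
  rw [blockSum, spaceNorm_sum_eq M Ψ A hJ (c := 1) (h := f) _ (by simp), one_mul]
  · intro k _ x
    rw [smul_apply, enorm_smul, enorm_weightFactor, enorm_modBlock, ← mul_assoc, two_rpow_mul,
      add_neg_cancel, ENNReal.rpow_zero]
  · exact fun k _ => ((spectrumIn_modBlock M hf k).mono (M.patch_subset_core hσ k)).const_smul _

theorem spectrumIn_dilBlock_core {σ : ℝ} (hσ : |σ| = 1) {f : 𝓢(𝔼, ℂ)}
    (hf : SpectrumIn f (M.patch 0 0 (3 * M.radius))) (k : ℕ) :
    SpectrumIn (dilBlock M σ f k) (M.core k) :=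
  (spectrumIn_dilBlock M hf k).mono (M.patch_subset_core hσ k)

theorem spaceNorm_dilSum_besov {A : SpaceParams} (hA : A.scale = Scale.B) {σ : ℝ} (hσ : |σ| = 1)
    {J : Finset ℕ} (hJ : J.Nonempty) {f : 𝓢(𝔼, ℂ)}
    (hf : SpectrumIn f (M.patch 0 0 (3 * M.radius))) :
    spaceNorm M Ψ A (blockSum (A.s - M.total * A.recip) J (dilBlock M σ f)) =
      (J.card : ℝ≥0∞) ^ (A.q⁻¹).toReal * eLpNorm f A.p volume := by
  rw [blockSum, spaceNorm_sum_besov M Ψ hA hJ]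
  · exact fun k _ => (spectrumIn_dilBlock_core M hσ hf k).const_smul _
  · intro k _
    rw [FunLike.coe_smul, eLpNorm_const_smul, enorm_weightFactor, eLpNorm_dilBlock,
      ← mul_assoc, ← mul_assoc, two_rpow_mul, two_rpow_mul, SpaceParams.recip]
    ring_nf
    rw [ENNReal.rpow_zero, one_mul]

theorem spaceNorm_dilBlock (A : SpaceParams) {σ : ℝ} (hσ : |σ| = 1) {f : 𝓢(𝔼, ℂ)}
    (hf : SpectrumIn f (M.patch 0 0 (3 * M.radius))) (k : ℕ) :
    spaceNorm M Ψ A (dilBlock M σ f k) =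
      (2 : ℝ≥0∞) ^ ((A.s - M.total * A.recip) * k) * eLpNorm f A.p volume := by
  rw [spaceNorm_of_core M Ψ A (spectrumIn_dilBlock_core M hσ hf k), eLpNorm_dilBlock, ← mul_assoc,
    two_rpow_mul, SpaceParams.recip]
  ring_nf

end Norms

/-! ### A band-limited profile -/

theorem fourier_fourier_apply (f : 𝓢(𝔼, ℂ)) (x : 𝔼) : 𝓕 (𝓕 f) x = f (-x) := by
  have h : f (-x) = 𝓕⁻ (𝓕 f) (-x) := by rw [FourierTransform.fourierInv_fourier_eq]
  rw [h, SchwartzMap.fourierInv_coe, Real.fourierInv_eq_fourier_neg, neg_neg,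
    SchwartzMap.fourier_coe (𝓕 f)]

theorem fourier_apply_zero (f : 𝓢(𝔼, ℂ)) : 𝓕 f 0 = ∫ x, f x := by
  simp [SchwartzMap.fourier_coe, Real.fourier_eq']

theorem exists_profile (M : AnisotropicWeight n) : ∃ f : 𝓢(𝔼, ℂ),
    SpectrumIn f (M.patch 0 0 M.radius) ∧ f 0 ≠ 0 ∧ 𝓕 (schwartzMul f f) 0 ≠ 0 := by
  have hr : 0 < M.radius / (2 * Real.pi) := div_pos M.radius_pos Real.two_pi_pos
  let φ : ContDiffBump (0 : 𝔼) :=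
    ⟨M.radius / (2 * Real.pi) / 2, M.radius / (2 * Real.pi), by positivity, by linarith⟩
  have hφ : HasCompactSupport fun x => (φ x : ℂ) :=
    φ.hasCompactSupport.comp_left (g := Complex.ofReal) rfl
  let Φ : 𝓢(𝔼, ℂ) := hφ.toSchwartzMap (Complex.ofRealCLM.contDiff.comp φ.contDiff)
  have hΦ (x : 𝔼) : Φ x = (φ x : ℂ) := rfl
  refine ⟨𝓕 Φ, fun η hη => ?_, ?_, ?_⟩
  · rw [fourier_fourier_apply, hΦ, Complex.ofReal_ne_zero, ← Function.mem_support, φ.support_eq,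
      mem_ball_zero_iff, norm_neg] at hη
    have hle : ‖η‖ * (2 * Real.pi) < M.radius := (lt_div_iff₀ Real.two_pi_pos).mp hη
    rw [M.mem_patch_zero_zero, norm_smul, Real.norm_of_nonneg Real.two_pi_pos.le]
    linarith
  · simp only [fourier_apply_zero, hΦ]
    rw [integral_complex_ofReal, Complex.ofReal_ne_zero]
    exact φ.integral_pos.ne'
  · simp only [fourier_apply_zero, schwartzMul_apply]
    rw [SchwartzMap.integral_fourier_mul_eq]
    simp only [fourier_fourier_apply, hΦ, φ.neg, ← Complex.ofReal_mul]
    rw [integral_complex_ofReal, Complex.ofReal_ne_zero]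
    refine (Continuous.integral_pos_of_hasCompactSupport_nonneg_nonzero (x := 0)
      (φ.continuous.mul φ.continuous) φ.hasCompactSupport.mul_right
      (fun x => mul_self_nonneg _) ?_).ne'
    rw [Pi.mul_apply, φ.one_of_mem_closedBall (Metric.mem_closedBall_self φ.rIn_pos.le)]
    norm_num

/-! ### Uniform limits of band parts -/

section Limits

theorem norm_fourierInv_apply_le (f : 𝓢(𝔼, ℂ)) (x : 𝔼) : ‖𝓕⁻ f x‖ ≤ ∫ η, ‖f η‖ := by
  rw [SchwartzMap.fourierInv_coe, Real.fourierInv_eq_fourier_neg]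
  exact VectorFourier.norm_fourierIntegral_le_integral_norm _ _ _ _ _

theorem norm_le_norm_toBoundedContinuousFunction (f : 𝓢(𝔼, ℂ)) (x : 𝔼) :
    ‖f x‖ ≤ ‖f.toBoundedContinuousFunction‖ :=
  f.toBoundedContinuousFunction.norm_coe_le_norm x

theorem norm_bandPart_le {χ : 𝓢(𝔼, ℂ)} {C : ℝ} (hC : ∀ ξ, ‖χ ξ‖ ≤ C) (f : 𝓢(𝔼, ℂ)) (x : 𝔼) :
    ‖bandPart χ f x‖ ≤ C * ∫ η, ‖𝓕 f η‖ := by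
  rw [bandPart_coe, ← integral_const_mul]
  refine (norm_fourierInv_apply_le _ x).trans (integral_mono (SchwartzMap.integrable _).norm
    ((𝓕 f).integrable.norm.const_mul C) fun η => ?_)
  simp only [schwartzMul_apply, norm_mul, scaledSymbol_apply]
  gcongr
  exact hC _

variable (M : AnisotropicWeight n)

theorem tendsto_integral_norm_mul_dilate_sub (u g : 𝓢(𝔼, ℂ)) :
    Tendsto (fun k : ℕ => ∫ η, ‖u η * (dilate M (-(k : ℤ)) g η - g 0)‖) atTop (𝓝 0) := by
  set C := ‖g.toBoundedContinuousFunction‖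
  rw [← integral_zero 𝔼 ℝ]
  refine tendsto_integral_of_dominated_convergence (fun η => ‖u η‖ * (C + C)) (fun k => ?_)
    (u.integrable.norm.mul_const _) (fun k => .of_forall fun η => ?_) (.of_forall fun η => ?_)
  · exact (u.continuous.mul ((SchwartzMap.continuous _).sub
      continuous_const)).norm.aestronglyMeasurable
  · rw [norm_norm, norm_mul]
    gcongr
    exact (norm_sub_le _ _).trans (add_le_add (norm_le_norm_toBoundedContinuousFunction g _)
      (norm_le_norm_toBoundedContinuousFunction g _))
  · have hg := (g.continuous.tendsto 0).comp (M.tendsto_dyadicDilation_neg η)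
    simpa [dilate_apply] using ((hg.sub_const (g 0)).const_mul (u η)).norm

theorem tendstoUniformly_fourierInv_mul_dilate (u g : 𝓢(𝔼, ℂ)) :
    TendstoUniformly (fun (k : ℕ) x => 𝓕⁻ (schwartzMul u (dilate M (-(k : ℤ)) g)) x)
      (fun x => g 0 * 𝓕⁻ u x) atTop := by
  refine Metric.tendstoUniformly_iff.mpr fun ε hε => ?_
  filter_upwards [(tendsto_integral_norm_mul_dilate_sub M u g).eventually (gt_mem_nhds hε)]
    with k hk x
  have hdiff : 𝓕⁻ (schwartzMul u (dilate M (-(k : ℤ)) g)) x - g 0 * 𝓕⁻ u x =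
      𝓕⁻ (schwartzMul u (dilate M (-(k : ℤ)) g) - g 0 • u) x := by
    rw [sub_eq_add_neg (schwartzMul _ _), FourierTransform.fourierInv_add,
      FourierTransform.fourierInv_neg, FourierTransform.fourierInv_smul, ← sub_eq_add_neg]
    rfl
  rw [dist_comm, dist_eq_norm, hdiff]
  refine (norm_fourierInv_apply_le _ x).trans_lt (lt_of_eq_of_lt ?_ hk)
  congr with η
  congr 1
  simp only [sub_apply, smul_apply, schwartzMul_apply, smul_eq_mul]
  ring

theorem tendstoUniformly_bandPart_dilate_symbol {ψ : 𝓢(𝔼, ℂ)} (hψ : ψ 0 = 1) (f : 𝓢(𝔼, ℂ)) :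
    TendstoUniformly (fun k : ℕ => bandPart (dilate M (-(k : ℤ)) ψ) f) f atTop := by
  have hsymbol (k : ℕ) : scaledSymbol (dilate M (-(k : ℤ)) ψ) =
      dilate M (-(k : ℤ)) (scaledSymbol ψ) := by
    ext η
    simp only [scaledSymbol_apply, dilate_apply, map_smul]
  have h := tendstoUniformly_fourierInv_mul_dilate M (𝓕 f) (scaledSymbol ψ)
  simp only [scaledSymbol_apply, smul_zero, hψ, one_mul,
    FourierTransform.fourierInv_fourier_eq] at h
  simpa only [bandPart_coe, hsymbol, schwartzMul_comm] using h

theorem isProduct_schwartzMul (f g : 𝓢(𝔼, ℂ)) : IsProduct M f g (schwartzMul f g) := by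
  intro ψ _ hψ φ _
  have hbound (u : 𝓢(𝔼, ℂ)) (k : ℕ) := norm_bandPart_le (χ := dilate M (-(k : ℤ)) ψ)
    (fun ξ => norm_le_norm_toBoundedContinuousFunction ψ _) u
  have hcont (u : 𝓢(𝔼, ℂ)) (k : ℕ) : Continuous (bandPart (dilate M (-(k : ℤ)) ψ) u) := by
    rw [bandPart_coe]
    exact SchwartzMap.continuous _
  have hlim (u : 𝓢(𝔼, ℂ)) (x : 𝔼) :=
    (tendstoUniformly_bandPart_dilate_symbol M hψ.self_of_nhds u).tendsto_at x
  rw [SchwartzMap.coe_apply]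
  refine tendsto_integral_of_dominated_convergence
    (fun x => (‖ψ.toBoundedContinuousFunction‖ * ∫ η, ‖𝓕 f η‖) *
      (‖ψ.toBoundedContinuousFunction‖ * ∫ η, ‖𝓕 g η‖) * ‖φ x‖) (fun k => ?_)
    (φ.integrable.norm.const_mul _) (fun k => .of_forall fun x => ?_) (.of_forall fun x => ?_)
  · exact (((hcont f k).mul (hcont g k)).mul φ.continuous).aestronglyMeasurable
  · rw [norm_mul, norm_mul]
    exact mul_le_mul_of_nonneg_right (mul_le_mul (hbound f k x) (hbound g k x) (norm_nonneg _)
      ((norm_nonneg _).trans (hbound f k x))) (norm_nonneg _)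
  · rw [smul_eq_mul, schwartzMul_apply, mul_comm (φ x)]
    exact ((hlim f x).mul (hlim g x)).mul_const _

theorem tendstoUniformly_bandPart_dilate (χ f : 𝓢(𝔼, ℂ)) :
    TendstoUniformly
      (fun (k : ℕ) x => ((2 : ℝ) ^ (k * M.total) : ℝ) * bandPart χ (dilate M k f) x)
      (fun x => 𝓕 f 0 * 𝓕⁻ (scaledSymbol χ) x) atTop := by
  have hF (k : ℕ) (x : 𝔼) : ((2 : ℝ) ^ (k * M.total) : ℝ) * bandPart χ (dilate M k f) x =
      𝓕⁻ (schwartzMul (scaledSymbol χ) (dilate M (-(k : ℤ)) (𝓕 f))) x := by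
    have hpow : ((2 : ℝ) ^ (k * M.total) : ℝ) * ((2 : ℝ) ^ (-(k * M.total)) : ℝ) = (1 : ℂ) := by
      rw [← Complex.ofReal_mul, ← Real.rpow_add two_pos, add_neg_cancel, Real.rpow_zero,
        Complex.ofReal_one]
    have hmul : schwartzMul (scaledSymbol χ) (dilate M (-(k : ℤ)) (𝓕 f)) =
        (((2 : ℝ) ^ (k * M.total) : ℝ) : ℂ) •
          schwartzMul (scaledSymbol χ) (𝓕 (dilate M k f)) := by
      ext η
      simp only [smul_apply, smul_eq_mul, schwartzMul_apply, fourier_dilate, Int.cast_natCast]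
      rw [mul_left_comm, ← mul_assoc _ _ (𝓕 f _), hpow, one_mul, dilate_apply]
    rw [hmul, FourierTransform.fourierInv_smul, bandPart_coe]
    rfl
  simpa only [hF] using tendstoUniformly_fourierInv_mul_dilate M (scaledSymbol χ) (𝓕 f)

theorem exists_fourierInv_scaledSymbol_dyadic_ne_zero (Ψ : DyadicCutoff) :
    ∃ x : 𝔼, 𝓕⁻ (scaledSymbol (Ψ.dyadicSchwartz M 0)) x ≠ 0 := by
  by_contra! h
  have hzero : scaledSymbol (Ψ.dyadicSchwartz M 0) = 0 := by
    have hinv : 𝓕⁻ (scaledSymbol (Ψ.dyadicSchwartz M 0)) = 0 := SchwartzMap.ext h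
    rw [← FourierTransform.fourier_fourierInv_eq (F := 𝓢(𝔼, ℂ)) (scaledSymbol _), hinv,
      FourierTransform.fourier_zero]
  have hcore : (0 : 𝔼) ∈ M.core 0 := ⟨by rw [M.size_zero]; norm_num, fun h => absurd rfl h⟩
  have hone : Ψ.dyadicSchwartz M 0 (0 : 𝔼) = 1 := M.dyadic_of_mem_core Ψ hcore 0
  have hval := congrArg (fun f : 𝓢(𝔼, ℂ) => f 0) hzero
  rw [scaledSymbol_apply, smul_zero, hone] at hval
  exact one_ne_zero hval

end Limits

/-! ### Lower bounds for `L_p` norms -/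

section LowerBounds

variable {α E : Type*} [TopologicalSpace α] [MeasurableSpace α] [OpensMeasurableSpace α]
  {μ : Measure α} [μ.IsOpenPosMeasure] [NormedAddCommGroup E]

theorem eLpNorm_indicator_ne_zero [SecondCountableTopologyEither α E] {f : α → E}
    (hf : Continuous f) {U : Set α} (hU : IsOpen U) {x₀ : α} (hx₀ : x₀ ∈ U) (h0 : f x₀ ≠ 0)
    {p : ℝ≥0∞} (hp : p ≠ 0) : eLpNorm (U.indicator f) p μ ≠ 0 := by
  rw [Ne, eLpNorm_eq_zero_iff (hf.aestronglyMeasurable.indicator hU.measurableSet) hp]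
  intro h
  have hopen : IsOpen (U ∩ {x | f x ≠ 0}) := hU.inter (isOpen_ne_fun hf continuous_const)
  refine (hopen.measure_pos μ ⟨x₀, hx₀, h0⟩).ne' (measure_mono_null (fun x hx => ?_) h)
  simpa [hx.1] using hx.2

theorem eLpNorm_ne_zero [SecondCountableTopologyEither α E] {f : α → E} (hf : Continuous f)
    {x₀ : α} (h0 : f x₀ ≠ 0) {p : ℝ≥0∞} (hp : p ≠ 0) : eLpNorm f p μ ≠ 0 := by
  simpa using eLpNorm_indicator_ne_zero hf isOpen_univ (Set.mem_univ x₀) h0 hp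

theorem card_mul_le_norm_sum {ι F : Type*} [SeminormedAddCommGroup F] [NormedSpace ℝ F]
    {J : Finset ι} {a : ι → F} {b : F} {δ : ℝ} (ha : ∀ i ∈ J, ‖a i - b‖ ≤ δ)
    (hb : 2 * δ ≤ ‖b‖) : J.card * δ ≤ ‖∑ i ∈ J, a i‖ := by
  have hsub : ‖∑ i ∈ J, a i - (J.card : ℝ) • b‖ ≤ J.card * δ := by
    rw [Nat.cast_smul_eq_nsmul, ← Finset.sum_const, ← Finset.sum_sub_distrib, ← nsmul_eq_mul]
    exact (norm_sum_le_of_le J ha).trans_eq (Finset.sum_const δ)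
  have hbig : J.card * (2 * δ) ≤ ‖(J.card : ℝ) • b‖ := by
    rw [norm_smul, Real.norm_natCast]
    gcongr
  have htri := norm_le_norm_add_norm_sub (∑ i ∈ J, a i) ((J.card : ℝ) • b)
  linarith

theorem exists_card_mul_le_eLpNorm_sum [NormedSpace ℝ E] {F : ℕ → α → E} {w : α → E}
    (hF : TendstoUniformly F w atTop) (hw : Continuous w) {x₀ : α} (h0 : w x₀ ≠ 0) {p : ℝ≥0∞}
    (hp : p ≠ 0) : ∃ c : ℝ≥0∞, c ≠ 0 ∧ ∃ K : ℕ, ∀ J : Finset ℕ, (∀ k ∈ J, K ≤ k) →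
      J.card * c ≤ eLpNorm (fun x => ∑ k ∈ J, F k x) p μ := by
  set δ : ℝ := ‖w x₀‖ / 4 with hδ
  have hδ0 : 0 < δ := by positivity
  obtain ⟨K, hK⟩ := eventually_atTop.mp (Metric.tendstoUniformly_iff.mp hF δ hδ0)
  let U : Set α := {x | 2 * δ < ‖w x‖}
  have hU : IsOpen U := isOpen_lt continuous_const hw.norm
  have hxU : x₀ ∈ U := show 2 * δ < _ by linarith [norm_pos_iff.mpr h0]
  refine ⟨eLpNorm (U.indicator fun _ => δ) p μ,
    eLpNorm_indicator_ne_zero continuous_const hU hxU hδ0.ne' hp, K, fun J hJ => ?_⟩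
  rw [← eLpNorm_const_mul_enorm (by simp)]
  refine eLpNorm_mono_enorm fun x => ?_
  rw [enorm_eq_self]
  by_cases hx : x ∈ U
  · have hsum : J.card * δ ≤ ‖∑ k ∈ J, F k x‖ := card_mul_le_norm_sum
      (fun k hk => by rw [← dist_eq_norm, dist_comm]; exact (hK k (hJ k hk) x).le) (le_of_lt hx)
    rw [Set.indicator_of_mem hx, ← ofReal_norm, ← ofReal_norm, Real.norm_of_nonneg hδ0.le,
      ← ENNReal.ofReal_natCast, ← ENNReal.ofReal_mul (by positivity)]
    exact ENNReal.ofReal_le_ofReal hsum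
  · simp [Set.indicator_of_notMem hx]

end LowerBounds

section Concentration

variable (M : AnisotropicWeight n)

theorem eventually_le_eLpNorm_mul_dilBlock {u f : 𝓢(𝔼, ℂ)} (hu : u 0 ≠ 0) (σ : ℝ) (p : ℝ≥0∞) :
    ∀ᶠ k : ℕ in atTop, ‖u 0‖ₑ / 2 * ((2 : ℝ≥0∞) ^ (-(k * M.total * (p⁻¹).toReal)) *
        eLpNorm ((Metric.ball 0 1).indicator f) p volume) ≤
      eLpNorm (schwartzMul u (dilBlock M σ f k)) p volume := by
  have hlt : ‖u 0‖ₑ / 2 < ‖u 0‖ₑ := ENNReal.half_lt_self (by simpa using hu) (by simp)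
  obtain ⟨r, hr, hball⟩ := Metric.eventually_nhds_iff_ball.mp
    (u.continuous.enorm.continuousAt.eventually (lt_mem_nhds hlt))
  have hsmall : ∀ᶠ k : ℕ in atTop, (2 : ℝ) ^ (-(k : ℤ)) < r := by
    have h := tendsto_pow_atTop_nhds_zero_of_lt_one (r := (2 : ℝ)⁻¹) (by norm_num) (by norm_num)
    simpa only [zpow_neg, zpow_natCast, inv_pow] using h.eventually (gt_mem_nhds hr)
  filter_upwards [hsmall] with k hk
  rw [← Int.cast_natCast (R := ℝ) k, ← M.eLpNorm_comp_dyadicDilation,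
    ← eLpNorm_const_mul_enorm (ENNReal.div_ne_top (by simp) (by norm_num))]
  refine eLpNorm_mono_enorm fun x => ?_
  rw [enorm_eq_self, schwartzMul_apply, enorm_mul, enorm_dilBlock]
  by_cases hx : M.dyadicDilation k x ∈ Metric.ball (0 : 𝔼) 1
  · rw [Set.indicator_of_mem hx]
    gcongr
    refine (hball x ?_).le
    rw [mem_ball_zero_iff] at hx ⊢
    rw [← M.dyadicDilation_neg_cancel k x]
    calc _ ≤ (2 : ℝ) ^ (-(k : ℤ)) * ‖M.dyadicDilation k x‖ :=
          M.norm_dyadicDilation_le (by omega) _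
      _ ≤ 2 ^ (-(k : ℤ)) := mul_le_of_le_one_right (by positivity) hx.le
      _ < r := hk
  · simp [Set.indicator_of_notMem hx]

theorem exists_le_eLpNorm_bandPart_dilates (Ψ : DyadicCutoff) {f : 𝓢(𝔼, ℂ)} (hf : 𝓕 f 0 ≠ 0)
    {p : ℝ≥0∞} (hp : p ≠ 0) : ∃ c : ℝ≥0∞, c ≠ 0 ∧ ∃ K : ℕ, ∀ J : Finset ℕ, (∀ k ∈ J, K ≤ k) →
      J.card * c ≤ eLpNorm (fun x => ∑ k ∈ J, weightFactor (-M.total) k *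
        bandPart (Ψ.dyadicSchwartz M 0) (dilate M k f) x) p volume := by
  have hw (k : ℕ) : weightFactor (-M.total) k = ((2 : ℝ) ^ (k * M.total) : ℝ) := by
    rw [weightFactor, neg_mul, neg_neg, mul_comm]
  simp only [hw]
  obtain ⟨x₀, hx₀⟩ := exists_fourierInv_scaledSymbol_dyadic_ne_zero M Ψ
  exact exists_card_mul_le_eLpNorm_sum (tendstoUniformly_bandPart_dilate M _ f)
    (continuous_const.mul (SchwartzMap.continuous _)) (mul_ne_zero hf hx₀) hp

end Concentration

/-! ### Upper bounds in Triebel–Lizorkin spaces -/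

theorem sum_le_geometric {J : Finset ℕ} {e : ℕ → ℕ} (he : Set.InjOn e J) {x : ℕ → ℝ≥0∞}
    {μ ρ : ℝ≥0∞} (h : ∀ k ∈ J, x k ≤ μ * ρ ^ e k) : ∑ k ∈ J, x k ≤ μ * (1 - ρ)⁻¹ := by
  refine (Finset.sum_le_sum h).trans ?_
  rw [← Finset.mul_sum, ← Finset.sum_image (f := fun i => ρ ^ i) he, ← ENNReal.tsum_geometric]
  gcongr
  exact ENNReal.sum_le_tsum _

theorem sum_le_of_geometric_growth {J : Finset ℕ} {x : ℕ → ℝ≥0∞} {K μ ρ : ℝ≥0∞}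
    (hμ : ∀ l ∈ J, x l ≤ μ) (h : ∀ k ∈ J, ∀ l ∈ J, k ≤ l → x k ≤ K * ρ ^ (l - k) * x l) :
    ∑ k ∈ J, x k ≤ K * μ * (1 - ρ)⁻¹ := by
  rcases J.eq_empty_or_nonempty with rfl | hJ
  · simp
  have hle : ∀ k ∈ J, k ≤ J.max' hJ := J.le_max'
  refine sum_le_geometric (e := fun k => J.max' hJ - k)
    (fun k hk l hl (hkl : J.max' hJ - k = J.max' hJ - l) => ?_) fun k hk => ?_
  · have := hle k hk
    have := hle l hl
    omega
  · refine (h k hk _ (J.max'_mem hJ) (hle k hk)).trans ?_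
    rw [mul_right_comm]
    gcongr
    exact hμ _ (J.max'_mem hJ)

theorem sum_le_of_geometric_decay {J : Finset ℕ} {x : ℕ → ℝ≥0∞} {K μ ρ : ℝ≥0∞}
    (hμ : ∀ l ∈ J, x l ≤ μ) (h : ∀ k ∈ J, ∀ l ∈ J, l ≤ k → x k ≤ K * ρ ^ (k - l) * x l) :
    ∑ k ∈ J, x k ≤ K * μ * (1 - ρ)⁻¹ := by
  rcases J.eq_empty_or_nonempty with rfl | hJ
  · simp
  have hle : ∀ k ∈ J, J.min' hJ ≤ k := fun k hk => J.min'_le k hk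
  refine sum_le_geometric (e := fun k => k - J.min' hJ)
    (fun k hk l hl (hkl : k - J.min' hJ = l - J.min' hJ) => ?_) fun k hk => ?_
  · have := hle k hk
    have := hle l hl
    omega
  · refine (h k hk _ (J.min'_mem hJ) (hle k hk)).trans ?_
    rw [mul_right_comm]
    gcongr
    exact hμ _ (J.min'_mem hJ)

theorem mul_pow_mul_rpow {r : ℝ} (hr : 0 ≤ r) (K ρ b : ℝ≥0∞) (i : ℕ) :
    (K * ρ ^ i * b) ^ r = K ^ r * (ρ ^ r) ^ i * b ^ r := by
  rw [ENNReal.mul_rpow_of_nonneg _ _ hr, ENNReal.mul_rpow_of_nonneg _ _ hr, ← ENNReal.rpow_natCast,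
    ← ENNReal.rpow_natCast, ← ENNReal.rpow_mul, ← ENNReal.rpow_mul, mul_comm (i : ℝ)]

theorem sum_le_of_peak {J : Finset ℕ} {x : ℕ → ℝ≥0∞} {K μ ρ : ℝ≥0∞} (P : ℕ → Prop)
    (hμ : ∀ l ∈ J, x l ≤ μ)
    (hgrowth : ∀ k ∈ J, ∀ l ∈ J, P l → k ≤ l → x k ≤ K * ρ ^ (l - k) * x l)
    (hdecay : ∀ k ∈ J, ∀ l ∈ J, ¬P l → l ≤ k → x k ≤ K * ρ ^ (k - l) * x l) :
    ∑ k ∈ J, x k ≤ 2 * (K * μ * (1 - ρ)⁻¹) := by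
  classical
  rw [← Finset.sum_filter_add_sum_filter_not J P, two_mul]
  refine add_le_add
    (sum_le_of_geometric_growth (fun l hl => hμ l (Finset.filter_subset _ _ hl))
      fun k hk l hl hkl => ?_)
    (sum_le_of_geometric_decay (fun l hl => hμ l (Finset.filter_subset _ _ hl))
      fun k hk l hl hlk => ?_)
  · rw [Finset.mem_filter] at hk hl
    exact hgrowth k hk.1 l hl.1 hl.2 hkl
  · rw [Finset.mem_filter] at hk hl
    exact hdecay k hk.1 l hl.1 hl.2 hlk

theorem exists_ellNorm_le_of_peak {q K ρ : ℝ≥0∞} (hq : q ≠ 0) (hK : K ≠ ⊤) (hρ : ρ < 1) :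
    ∃ C ≠ ⊤, ∀ (b : ℕ → ℝ≥0∞) (J : Finset ℕ) (P : ℕ → Prop),
      (∀ k ∈ J, ∀ l ∈ J, P l → k ≤ l → b k ≤ K * ρ ^ (l - k) * b l) →
      (∀ k ∈ J, ∀ l ∈ J, ¬P l → l ≤ k → b k ≤ K * ρ ^ (k - l) * b l) →
      ellNorm q (fun j => if j ∈ J then b j else 0) ≤ C * J.sup b := by
  by_cases hqt : q = ⊤
  · refine ⟨1, ENNReal.one_ne_top, fun b J _ _ _ => ?_⟩
    rw [ellNorm, if_pos hqt, one_mul]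
    refine iSup_le fun j => ?_
    split_ifs with hj
    · exact Finset.le_sup hj
    · exact zero_le
  have hq' : 0 < q.toReal := ENNReal.toReal_pos hq hqt
  have hρq : ρ ^ q.toReal < 1 := ENNReal.rpow_lt_one hρ hq'
  set S : ℝ≥0∞ := 2 * (K ^ q.toReal * (1 - ρ ^ q.toReal)⁻¹) with hSdef
  have hS : S ≠ ⊤ := ENNReal.mul_ne_top ENNReal.ofNat_ne_top
    (ENNReal.mul_ne_top (ENNReal.rpow_ne_top_of_nonneg hq'.le hK)
      (ENNReal.inv_ne_top.mpr (tsub_pos_of_lt hρq).ne'))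
  refine ⟨S ^ (1 / q.toReal), ENNReal.rpow_ne_top_of_nonneg (by positivity) hS,
    fun b J P hgrowth hdecay => ?_⟩
  have hpow {k l i : ℕ} (h : b k ≤ K * ρ ^ i * b l) :
      b k ^ q.toReal ≤ K ^ q.toReal * (ρ ^ q.toReal) ^ i * b l ^ q.toReal :=
    (ENNReal.rpow_le_rpow h hq'.le).trans_eq (mul_pow_mul_rpow hq'.le K ρ (b l) i)
  have hsum : ∑ k ∈ J, b k ^ q.toReal ≤ S * J.sup b ^ q.toReal := by
    refine (sum_le_of_peak P (fun l hl => ENNReal.rpow_le_rpow (Finset.le_sup hl) hq'.le)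
      (fun k hk l hl hP hkl => hpow (hgrowth k hk l hl hP hkl))
      (fun k hk l hl hP hlk => hpow (hdecay k hk l hl hP hlk))).trans_eq ?_
    rw [hSdef, mul_right_comm, mul_assoc 2]
  rw [ellNorm, if_neg hqt, tsum_eq_sum (s := J) (fun j hj => by simp [hj, hq']),
    Finset.sum_congr rfl (g := fun k => b k ^ q.toReal) (fun j hj => by simp [hj])]
  refine (ENNReal.rpow_le_rpow hsum (by positivity)).trans_eq ?_
  rw [ENNReal.mul_rpow_of_nonneg _ _ (by positivity), ← ENNReal.rpow_mul,
    mul_one_div_cancel hq'.ne', ENNReal.rpow_one]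

theorem ellNorm_const_mul {q : ℝ≥0∞} (hq : q ≠ 0) (c : ℝ≥0∞) (b : ℕ → ℝ≥0∞) :
    ellNorm q (fun j => c * b j) = c * ellNorm q b := by
  unfold ellNorm
  split_ifs with hqt
  · rw [ENNReal.mul_iSup]
  · have hq' : 0 < q.toReal := ENNReal.toReal_pos hq hqt
    simp only [ENNReal.mul_rpow_of_nonneg _ _ hq'.le]
    rw [ENNReal.tsum_mul_left, ENNReal.mul_rpow_of_nonneg _ _ (by positivity),
      ← ENNReal.rpow_mul, mul_one_div_cancel hq'.ne', ENNReal.rpow_one]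

theorem eLpNorm_finset_sup_le {α : Type*} [MeasurableSpace α] {μ : Measure α} {p : ℝ≥0∞}
    (hp0 : p ≠ 0) (hp : p ≠ ⊤) {J : Finset ℕ} {h : ℕ → α → ℝ≥0∞}
    (hmeas : ∀ k ∈ J, Measurable (h k)) {D : ℝ≥0∞} (hD : ∀ k ∈ J, eLpNorm (h k) p μ ≤ D) :
    eLpNorm (fun x => J.sup fun k => h k x) p μ ≤ (J.card : ℝ≥0∞) ^ (p⁻¹).toReal * D := by
  have hp' : 0 < p.toReal := ENNReal.toReal_pos hp0 hp
  have hint : ∀ k ∈ J, ∫⁻ x, h k x ^ p.toReal ∂μ ≤ D ^ p.toReal := by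
    intro k hk
    have := ENNReal.rpow_le_rpow (hD k hk) hp'.le
    rw [eLpNorm_eq_lintegral_rpow_enorm_toReal hp0 hp, ← ENNReal.rpow_mul,
      one_div_mul_cancel hp'.ne', ENNReal.rpow_one] at this
    simpa only [enorm_eq_self] using this
  have hsup (x : α) : (J.sup fun k => h k x) ^ p.toReal ≤ ∑ k ∈ J, h k x ^ p.toReal := by
    rcases J.eq_empty_or_nonempty with rfl | hJ
    · simp [hp']
    · obtain ⟨k, hk, hkx⟩ := J.exists_mem_eq_sup hJ fun k => h k x
      rw [hkx]
      exact Finset.single_le_sum (f := fun k => h k x ^ p.toReal) (fun _ _ => zero_le) hk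
  rw [eLpNorm_eq_lintegral_rpow_enorm_toReal hp0 hp]
  simp only [enorm_eq_self]
  calc (∫⁻ x, (J.sup fun k => h k x) ^ p.toReal ∂μ) ^ (1 / p.toReal)
      ≤ (∫⁻ x, ∑ k ∈ J, h k x ^ p.toReal ∂μ) ^ (1 / p.toReal) := by
        gcongr with x
        exact hsup x
    _ ≤ (J.card * D ^ p.toReal) ^ (1 / p.toReal) := by
        rw [lintegral_finsetSum J fun k hk => (hmeas k hk).pow_const _, ← nsmul_eq_mul,
          ← Finset.sum_const]
        gcongr with k hk
        exact hint k hk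
    _ = _ := by
        rw [ENNReal.mul_rpow_of_nonneg _ _ (by positivity), ← ENNReal.rpow_mul,
          mul_one_div_cancel hp'.ne', ENNReal.rpow_one, ENNReal.toReal_inv, one_div]

section Envelope

variable (M : AnisotropicWeight n)

/-- The majorant `2^{ak} (1 + |2^{kM} x|)^{-D}` of a block of amplitude `2^{ak}` concentrated near
the origin at scale `2^{-kM}`. -/
def blockEnvelope (a : ℝ) (D k : ℕ) (x : 𝔼) : ℝ≥0∞ :=
  2 ^ (a * k) * ((1 + ‖M.dyadicDilation k x‖ₑ) ^ D)⁻¹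

theorem two_rpow_mul_natCast (a : ℝ) (i : ℕ) : (2 : ℝ≥0∞) ^ (a * i) = (2 ^ a) ^ i := by
  rw [ENNReal.rpow_mul, ENNReal.rpow_natCast]

theorem measurable_blockEnvelope (a : ℝ) (D k : ℕ) : Measurable (blockEnvelope M a D k) :=
  (((M.dyadicDilation k).continuous.measurable.enorm.const_add 1).pow_const D).inv.const_mul _

theorem blockEnvelope_le_of_norm_le_one {a : ℝ} {D k l : ℕ} {x : 𝔼} (hkl : k ≤ l)
    (hx : ‖M.dyadicDilation l x‖ₑ ≤ 1) :
    blockEnvelope M a D k x ≤ 2 ^ D * (2 ^ (-a)) ^ (l - k) * blockEnvelope M a D l x := by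
  have hk : ((1 + ‖M.dyadicDilation k x‖ₑ) ^ D)⁻¹ ≤ 1 :=
    ENNReal.inv_le_one.mpr (one_le_pow₀ le_self_add)
  have hl : (1 : ℝ≥0∞) ≤ 2 ^ D * ((1 + ‖M.dyadicDilation l x‖ₑ) ^ D)⁻¹ := by
    rw [← div_eq_mul_inv, ENNReal.le_div_iff_mul_le (by simp) (by simp), one_mul]
    gcongr
    exact (add_le_add_right hx 1).trans_eq one_add_one_eq_two
  calc blockEnvelope M a D k x ≤ 2 ^ (a * k) * 1 := by
        unfold blockEnvelope
        gcongr
    _ ≤ 2 ^ (-a * (l - k : ℕ)) * 2 ^ (a * l) *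
          (2 ^ D * ((1 + ‖M.dyadicDilation l x‖ₑ) ^ D)⁻¹) := by
        rw [two_rpow_mul, Nat.cast_sub hkl]
        gcongr
        · norm_num
        · linarith
    _ = _ := by
        rw [two_rpow_mul_natCast (-a), blockEnvelope]
        ring

theorem two_pow_mul_enorm_dyadicDilation_le {k l : ℕ} (hlk : l ≤ k) (x : 𝔼) :
    2 ^ (k - l) * ‖M.dyadicDilation l x‖ₑ ≤ ‖M.dyadicDilation k x‖ₑ := by
  have h := M.norm_dyadicDilation_le (k := -((k - l : ℕ) : ℤ)) (by omega) (M.dyadicDilation k x)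
  rw [← M.dyadicDilation_add, show -((k - l : ℕ) : ℤ) + k = l by omega, zpow_neg, zpow_natCast,
    le_inv_mul_iff₀ (by positivity)] at h
  have h' := ENNReal.ofReal_le_ofReal h
  rwa [ENNReal.ofReal_mul (by positivity), ENNReal.ofReal_pow two_pos.le, ENNReal.ofReal_ofNat,
    ofReal_norm, ofReal_norm] at h'

theorem inv_one_add_enorm_dyadicDilation_pow_le {k l : ℕ} (hlk : l ≤ k) {x : 𝔼}
    (hx : 1 ≤ ‖M.dyadicDilation l x‖ₑ) (D : ℕ) :
    ((1 + ‖M.dyadicDilation k x‖ₑ) ^ D)⁻¹ ≤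
      2 ^ D * (2 ^ (-(D : ℝ))) ^ (k - l) * ((1 + ‖M.dyadicDilation l x‖ₑ) ^ D)⁻¹ := by
  have hbracket : 2 ^ (k - l) * (1 + ‖M.dyadicDilation l x‖ₑ) ≤
      (1 + ‖M.dyadicDilation k x‖ₑ) * 2 :=
    calc 2 ^ (k - l) * (1 + ‖M.dyadicDilation l x‖ₑ)
        ≤ 2 ^ (k - l) * ‖M.dyadicDilation l x‖ₑ * 2 := by
          rw [mul_assoc, mul_two]
          gcongr
      _ ≤ _ := by
          gcongr
          exact (two_pow_mul_enorm_dyadicDilation_le M hlk x).trans le_add_self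
  have hinv : (2 ^ (-(D : ℝ))) ^ (k - l) = (((2 : ℝ≥0∞) ^ (k - l)) ^ D)⁻¹ := by
    rw [ENNReal.rpow_neg, ENNReal.rpow_natCast, ← ENNReal.inv_pow, ← pow_mul, ← pow_mul, mul_comm]
  rw [hinv, mul_assoc, ← ENNReal.mul_inv (by simp) (by simp), ← mul_pow, ← div_eq_mul_inv,
    ENNReal.le_div_iff_mul_le (by simp) (by simp), ENNReal.inv_mul_le_iff (by simp) (by simp),
    ← mul_pow]
  gcongr

theorem blockEnvelope_le_of_one_le_norm {a : ℝ} {D k l : ℕ} {x : 𝔼} (hD : 2 * a ≤ D) (hlk : l ≤ k)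
    (hx : 1 ≤ ‖M.dyadicDilation l x‖ₑ) :
    blockEnvelope M a D k x ≤ 2 ^ D * (2 ^ (-a)) ^ (k - l) * blockEnvelope M a D l x := by
  have hexp : (2 : ℝ≥0∞) ^ (a * k) * (2 ^ (-(D : ℝ))) ^ (k - l) ≤
      (2 ^ (-a)) ^ (k - l) * 2 ^ (a * l) := by
    have : (l : ℝ) ≤ k := by exact_mod_cast hlk
    rw [← two_rpow_mul_natCast, ← two_rpow_mul_natCast, two_rpow_mul, two_rpow_mul,
      Nat.cast_sub hlk]
    refine ENNReal.rpow_le_rpow_of_exponent_le (by norm_num) ?_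
    nlinarith
  calc blockEnvelope M a D k x
      ≤ 2 ^ (a * k) * (2 ^ D * (2 ^ (-(D : ℝ))) ^ (k - l) *
          ((1 + ‖M.dyadicDilation l x‖ₑ) ^ D)⁻¹) := by
        unfold blockEnvelope
        gcongr
        exact inv_one_add_enorm_dyadicDilation_pow_le M hlk hx D
    _ = 2 ^ D * (2 ^ (a * k) * (2 ^ (-(D : ℝ))) ^ (k - l)) *
          ((1 + ‖M.dyadicDilation l x‖ₑ) ^ D)⁻¹ := by ring
    _ ≤ 2 ^ D * ((2 ^ (-a)) ^ (k - l) * 2 ^ (a * l)) *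
          ((1 + ‖M.dyadicDilation l x‖ₑ) ^ D)⁻¹ := by gcongr
    _ = _ := by rw [blockEnvelope]; ring

theorem exists_ellNorm_blockEnvelope_le {q : ℝ≥0∞} (hq : q ≠ 0) {a : ℝ} (ha : 0 < a) {D : ℕ}
    (hD : 2 * a ≤ D) : ∃ C ≠ ⊤, ∀ (J : Finset ℕ) (x : 𝔼),
      ellNorm q (fun j => if j ∈ J then blockEnvelope M a D j x else 0) ≤
        C * J.sup fun j => blockEnvelope M a D j x := by
  obtain ⟨C, hC, h⟩ := exists_ellNorm_le_of_peak hq (K := 2 ^ D) (by simp)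
    (ENNReal.rpow_lt_one_of_one_lt_of_neg (x := 2) (by norm_num) (neg_lt_zero.mpr ha))
  exact ⟨C, hC, fun J x => h _ J (fun l => ‖M.dyadicDilation l x‖ₑ ≤ 1)
    (fun k _ l _ hl hkl => blockEnvelope_le_of_norm_le_one M hkl hl)
    (fun k _ l _ hl hlk => blockEnvelope_le_of_one_le_norm M hD hlk (not_le.mp hl).le)⟩

theorem eLpNorm_blockEnvelope (p : ℝ≥0∞) (D k : ℕ) :
    eLpNorm (blockEnvelope M (M.total * (p⁻¹).toReal) D k) p volume =
      eLpNorm (fun x : 𝔼 => (((1 + ‖x‖) ^ D)⁻¹ : ℝ)) p volume := by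
  have hbracket (y : 𝔼) : ((1 + ‖y‖ₑ) ^ D)⁻¹ = ‖(((1 + ‖y‖) ^ D)⁻¹ : ℝ)‖ₑ := by
    rw [enorm_inv (by positivity), enorm_pow, Real.enorm_of_nonneg (by positivity),
      ENNReal.ofReal_add zero_le_one (norm_nonneg y), ENNReal.ofReal_one, ofReal_norm]
  have henv : blockEnvelope M (M.total * (p⁻¹).toReal) D k = fun x =>
      2 ^ (M.total * (p⁻¹).toReal * k) *
        ‖(((1 + ‖M.dyadicDilation k x‖) ^ D)⁻¹ : ℝ)‖ₑ := by
    ext x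
    rw [blockEnvelope, hbracket]
  rw [henv, eLpNorm_const_mul_enorm (two_rpow_ne_top _)
      fun x => (((1 + ‖M.dyadicDilation k x‖) ^ D)⁻¹ : ℝ),
    M.eLpNorm_comp_dyadicDilation k p fun y => (((1 + ‖y‖) ^ D)⁻¹ : ℝ), ← mul_assoc, two_rpow_mul]
  push_cast
  ring_nf
  rw [ENNReal.rpow_zero, one_mul]

theorem exists_eLpNorm_inv_one_add_norm_pow_ne_top (p : ℝ≥0∞) (B : ℝ) :
    ∃ D : ℕ, B ≤ D ∧ eLpNorm (fun x : 𝔼 => (((1 + ‖x‖) ^ D)⁻¹ : ℝ)) p volume ≠ ⊤ := by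
  obtain ⟨D₀, hD₀⟩ := Measure.HasTemperateGrowth.exists_eLpNorm_lt_top (E := 𝔼) p
    (μ := volume) inferInstance
  obtain ⟨D, hD⟩ := exists_nat_ge (max B D₀)
  refine ⟨D, (le_max_left _ _).trans hD, ((eLpNorm_mono fun x => ?_).trans_lt hD₀).ne⟩
  have hDD : D₀ ≤ D := by exact_mod_cast (le_max_right _ _).trans hD
  rw [Real.norm_of_nonneg (by positivity), Real.norm_of_nonneg (by positivity),
    Real.rpow_neg (by positivity), Real.rpow_natCast]
  gcongr
  linarith [norm_nonneg x]

theorem exists_enorm_le_inv_one_add_enorm_pow (f : 𝓢(𝔼, ℂ)) (D : ℕ) :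
    ∃ C ≠ ⊤, ∀ x, ‖f x‖ₑ ≤ C * ((1 + ‖x‖ₑ) ^ D)⁻¹ := by
  obtain ⟨C, hC⟩ : ∃ C, ∀ x, (1 + ‖x‖) ^ D * ‖f x‖ ≤ C :=
    ⟨_, fun x => by simpa using
      SchwartzMap.one_add_le_sup_seminorm_apply (𝕜 := ℂ) (m := (D, 0)) le_rfl le_rfl f x⟩
  refine ⟨ENNReal.ofReal C, ENNReal.ofReal_ne_top, fun x => ?_⟩
  rw [← div_eq_mul_inv, ENNReal.le_div_iff_mul_le (by simp) (by simp), mul_comm, ← ofReal_norm,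
    ← ofReal_norm, ← ENNReal.ofReal_one, ← ENNReal.ofReal_add zero_le_one (norm_nonneg x),
    ← ENNReal.ofReal_pow (by positivity), ← ENNReal.ofReal_mul (by positivity)]
  exact ENNReal.ofReal_le_ofReal (hC x)

theorem enorm_bandPart_dilSum (Ψ : DyadicCutoff) {σ : ℝ} (hσ : |σ| = 1) {f : 𝓢(𝔼, ℂ)}
    (hf : SpectrumIn f (M.patch 0 0 (3 * M.radius))) (s a : ℝ) (J : Finset ℕ) (j : ℕ) (x : 𝔼) :
    (2 : ℝ≥0∞) ^ (s * j) *
        ‖bandPart (Ψ.dyadicSchwartz M j) (blockSum (s - a) J (dilBlock M σ f)) x‖ₑ =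
      if j ∈ J then 2 ^ (a * j) * ‖f (M.dyadicDilation j x)‖ₑ else 0 := by
  rw [blockSum, bandPart_sum_core M Ψ fun k _ =>
    (spectrumIn_dilBlock_core M hσ hf k).const_smul _]
  split_ifs with hj
  · rw [smul_apply, enorm_smul, enorm_weightFactor, enorm_dilBlock, ← mul_assoc, two_rpow_mul]
    ring_nf
  · simp

theorem exists_spaceNorm_dilSum_triebel_le (Ψ : DyadicCutoff) {A : SpaceParams}
    (hA : A.scale = Scale.F) {σ : ℝ} (hσ : |σ| = 1) {f : 𝓢(𝔼, ℂ)}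
    (hf : SpectrumIn f (M.patch 0 0 (3 * M.radius))) :
    ∃ C ≠ ⊤, ∀ J : Finset ℕ,
      spaceNorm M Ψ A (blockSum (A.s - M.total * A.recip) J (dilBlock M σ f)) ≤
        (J.card : ℝ≥0∞) ^ A.recip * C := by
  have hp := A.p_lt_top hA
  have ha : 0 < M.total * A.recip := mul_pos M.total_pos
    (ENNReal.toReal_pos (ENNReal.inv_ne_zero.mpr hp.ne) (ENNReal.inv_ne_top.mpr A.p_pos.ne'))
  obtain ⟨D, hD, hbracket⟩ := exists_eLpNorm_inv_one_add_norm_pow_ne_top (n := n) A.p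
    (2 * (M.total * A.recip))
  obtain ⟨C₁, hC₁, hdecay⟩ := exists_enorm_le_inv_one_add_enorm_pow f D
  obtain ⟨C₂, hC₂, hpeak⟩ := exists_ellNorm_blockEnvelope_le M A.q_pos.ne' ha hD
  lift C₁ to ℝ≥0 using hC₁
  lift C₂ to ℝ≥0 using hC₂
  refine ⟨_, ENNReal.mul_ne_top (ENNReal.coe_ne_top (r := C₁ * C₂)) hbracket, fun J => ?_⟩
  have hpointwise (x : 𝔼) : ellNorm A.q (fun j => (2 : ℝ≥0∞) ^ (A.s * j) *
        ‖bandPart (Ψ.dyadicSchwartz M j)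
          (blockSum (A.s - M.total * A.recip) J (dilBlock M σ f)) x‖ₑ) ≤
      (C₁ * C₂ : ℝ≥0) * J.sup fun j => blockEnvelope M (M.total * A.recip) D j x := by
    rw [ENNReal.coe_mul, mul_assoc]
    refine (ellNorm_mono A.q_pos.ne' fun j => ?_).trans
      ((ellNorm_const_mul A.q_pos.ne' C₁ _).trans_le (by gcongr; exact hpeak J x))
    rw [enorm_bandPart_dilSum M Ψ hσ hf]
    split_ifs
    · rw [blockEnvelope, mul_left_comm]
      gcongr
      exact hdecay _
    · exact zero_le
  rw [spaceNorm_of_triebel M Ψ hA, mul_left_comm]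
  refine (eLpNorm_le_nnreal_smul_eLpNorm_of_ae_le_mul' (c := C₁ * C₂)
    (g := fun x => J.sup fun j => blockEnvelope M (M.total * A.recip) D j x)
    (.of_forall fun x => by simpa only [enorm_eq_self] using hpointwise x) A.p).trans ?_
  rw [ENNReal.smul_def, smul_eq_mul]
  gcongr
  exact eLpNorm_finset_sup_le A.p_pos.ne' hp.ne
    (fun k _ => measurable_blockEnvelope M _ D k) fun k _ => (eLpNorm_blockEnvelope M A.p D k).le

end Envelope

/-! ### Products of blocks -/

section Products

variable {M : AnisotropicWeight n} {Ψ : DyadicCutoff} {f : 𝓢(EuclideanSpace ℝ (Fin n), ℂ)}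

theorem SpectrumIn.patch_three {σ : ℝ} {k : ℤ} (hf : SpectrumIn f (M.patch σ k M.radius)) :
    SpectrumIn f (M.patch σ k (3 * M.radius)) :=
  hf.mono (M.patch_mono (by linarith [M.radius_pos]))

theorem SpectrumIn.mul_self (hf : SpectrumIn f (M.patch 0 0 M.radius)) :
    SpectrumIn (_root_.schwartzMul f f) (M.patch 0 0 (3 * M.radius)) := by
  refine (hf.schwartzMul hf).mono (M.patch_add_patch_subset.trans ?_)
  rw [add_zero]
  exact M.patch_mono (by linarith [M.radius_pos])

theorem SpectrumIn.mul_low {f g : 𝓢(𝔼, ℂ)} {σ : ℝ} (hσ : |σ| = 1) {k : ℕ}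
    (hf : SpectrumIn f (M.patch σ k M.radius)) (hg : SpectrumIn g (M.patch 0 0 M.radius)) :
    SpectrumIn (_root_.schwartzMul f g) (M.core k) :=
  (hf.schwartzMul hg).mono (((M.patch_add_low_patch_subset (by omega)).trans
    (M.patch_mono (by linarith [M.radius_pos]))).trans (M.patch_subset_core hσ k))

theorem SpectrumIn.mul_far {f g : 𝓢(𝔼, ℂ)} {σ τ : ℝ} (hσ : |σ| = 1) (hτ : |τ| = 1) {k l : ℕ}
    (hkl : l + M.gap ≤ k) (hf : SpectrumIn f (M.patch σ k M.radius))
    (hg : SpectrumIn g (M.patch τ l M.radius)) :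
    SpectrumIn (_root_.schwartzMul f g) (M.core k) :=
  (hf.schwartzMul hg).mono
    ((M.patch_add_far_patch_subset hτ.le (by omega)).trans (M.patch_subset_core hσ k))

/-- In a product of lacunary sums the off-diagonal terms keep the larger of the two frequencies. -/
theorem bandPart_mul_blockSum {F G : ℕ → 𝓢(𝔼, ℂ)} {σ τ : ℝ} (hσ : |σ| = 1) (hτ : |τ| = 1)
    (hF : ∀ k : ℕ, SpectrumIn (F k) (M.patch σ k M.radius))
    (hG : ∀ k : ℕ, SpectrumIn (G k) (M.patch τ k M.radius))
    {J : Finset ℕ} (hJ : Sparse M.gap J) (s t : ℝ) {j : ℕ} (hj : j ∉ J) (x : 𝔼) :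
    bandPart (Ψ.dyadicSchwartz M j) (schwartzMul (blockSum s J F) (blockSum t J G)) x =
      ∑ k ∈ J, weightFactor (s + t) k *
        bandPart (Ψ.dyadicSchwartz M j) (schwartzMul (F k) (G k)) x := by
  rw [schwartzMul_blockSum_blockSum, bandPart_sum, Finset.sum_product]
  refine Finset.sum_congr rfl fun k hk => ?_
  rw [Finset.sum_eq_single_of_mem k hk, bandPart_smul, weightFactor_mul]
  intro l hl hlk
  rw [bandPart_smul]
  rcases hJ hk hl hlk.symm with h | h
  · rw [schwartzMul_comm, bandPart_of_core M Ψ (SpectrumIn.mul_far hτ hσ h (hG l) (hF k)),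
      if_neg (by rintro rfl; exact hj hl), mul_zero]
  · rw [bandPart_of_core M Ψ (SpectrumIn.mul_far hσ hτ h (hF k) (hG l)),
      if_neg (by rintro rfl; exact hj hk), mul_zero]

theorem schwartzMul_modBlock_neg (f : 𝓢(𝔼, ℂ)) (k : ℕ) :
    schwartzMul (modBlock M 1 f k) (modBlock M (-1) f k) = schwartzMul f f := by
  rw [modBlock, modBlock, schwartzMul_waveMul, ← add_smul, neg_mul, add_neg_cancel, zero_smul,
    waveMul_zero]

theorem schwartzMul_modBlock (f g : 𝓢(𝔼, ℂ)) (σ : ℝ) (k : ℕ) :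
    schwartzMul (modBlock M σ f k) g = modBlock M σ (schwartzMul f g) k := by
  conv_lhs => rw [← waveMul_zero g]
  rw [modBlock, modBlock, schwartzMul_waveMul, add_zero]

theorem schwartzMul_dilBlock (f g : 𝓢(𝔼, ℂ)) (σ τ : ℝ) (k : ℕ) :
    schwartzMul (dilBlock M σ f k) (dilBlock M τ g k) =
      dilBlock M (σ + τ) (schwartzMul f g) k := by
  rw [dilBlock, dilBlock, dilBlock, schwartzMul_dilate, schwartzMul_waveMul, add_smul]

theorem dilBlock_zero (f : 𝓢(𝔼, ℂ)) (k : ℕ) : dilBlock M 0 f k = dilate M k f := by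
  rw [dilBlock, zero_smul, waveMul_zero]

theorem spectrumIn_dilBlock_two (hf : SpectrumIn f (M.patch 0 0 (3 * M.radius))) (k : ℕ) :
    SpectrumIn (dilBlock M 2 f k) (M.core (k + 1)) :=
  (spectrumIn_dilBlock M hf k).mono
    ((M.patch_two_subset k).trans (M.patch_subset_core (by simp) (k + 1)))

theorem bandPart_modSum_mul_modSum_neg (hf : SpectrumIn f (M.patch 0 0 M.radius)) {J : Finset ℕ}
    (hJ : Sparse M.gap J) (hJ₀ : 0 ∉ J) {s t : ℝ} (hst : s + t = 0) :
    bandPart (Ψ.dyadicSchwartz M 0)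
        (schwartzMul (blockSum s J (modBlock M 1 f)) (blockSum t J (modBlock M (-1) f))) =
      (J.card : ℂ) • ⇑(schwartzMul f f) := by
  ext x
  rw [bandPart_mul_blockSum (by simp) (by simp) (spectrumIn_modBlock M hf)
    (spectrumIn_modBlock M hf) hJ _ _ hJ₀, hst]
  simp only [schwartzMul_modBlock_neg, weightFactor_zero, one_mul]
  rw [bandPart_of_core M Ψ (hf.mul_self.mono (M.patch_zero_subset_core le_rfl)), if_pos rfl,
    Finset.sum_const, nsmul_eq_mul, Pi.smul_apply, smul_eq_mul]

theorem bandPart_dilSum_mul_dilSum (hf : SpectrumIn f (M.patch 0 0 M.radius)) {J : Finset ℕ}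
    (hJ : Sparse M.gap J) (s t : ℝ) {k : ℕ} (hk : k ∈ J) :
    bandPart (Ψ.dyadicSchwartz M (k + 1))
        (schwartzMul (blockSum s J (dilBlock M 1 f)) (blockSum t J (dilBlock M 1 f))) =
      weightFactor (s + t) k • ⇑(dilBlock M 2 (schwartzMul f f) k) := by
  have hk' : k + 1 ∉ J := fun hk₁ => by
    have hgap := M.two_le_radius_mul_two_pow_gap
    have := hJ hk hk₁ (by omega)
    have hne := M.gap_ne_zero
    have : M.gap = 1 := by omega
    rw [this] at hgap
    linarith [M.three_mul_radius_lt_one]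
  ext x
  rw [bandPart_mul_blockSum (by simp) (by simp) (spectrumIn_dilBlock M hf)
    (spectrumIn_dilBlock M hf) hJ _ _ hk']
  simp only [schwartzMul_dilBlock, one_add_one_eq_two,
    bandPart_of_core M Ψ (spectrumIn_dilBlock_two hf.mul_self _), add_left_inj, mul_ite, mul_zero]
  rw [Finset.sum_ite_eq, if_pos hk]
  rfl

theorem bandPart_dilSum_mul_dilSum_neg (hf : SpectrumIn f (M.patch 0 0 M.radius)) {J : Finset ℕ}
    (hJ : Sparse M.gap J) (hJ₀ : 0 ∉ J) (s t : ℝ) :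
    bandPart (Ψ.dyadicSchwartz M 0)
        (schwartzMul (blockSum s J (dilBlock M 1 f)) (blockSum t J (dilBlock M (-1) f))) =
      fun x => ∑ k ∈ J, weightFactor (s + t) k *
        bandPart (Ψ.dyadicSchwartz M 0) (dilate M k (schwartzMul f f)) x := by
  ext x
  rw [bandPart_mul_blockSum (by simp) (by simp) (spectrumIn_dilBlock M hf)
    (spectrumIn_dilBlock M hf) hJ _ _ hJ₀]
  simp only [schwartzMul_dilBlock, add_neg_cancel, dilBlock_zero]

theorem dilSum_apply_zero (σ : ℝ) (f : 𝓢(𝔼, ℂ)) (J : Finset ℕ) :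
    blockSum 0 J (dilBlock M σ f) 0 = J.card * f 0 := by
  simp [blockSum, sum_apply, weightFactor_zero, dilBlock, dilate_apply, waveMul_apply]

/-! ### Quasi-norms of single blocks -/

theorem spaceNorm_of_low (A : SpaceParams) (hf : SpectrumIn f (M.patch 0 0 (3 * M.radius))) :
    spaceNorm M Ψ A f = eLpNorm f A.p volume := by
  rw [spaceNorm_of_core M Ψ A (hf.mono (M.patch_zero_subset_core le_rfl)), Nat.cast_zero, mul_zero,
    ENNReal.rpow_zero, one_mul]

theorem spaceNorm_modBlock (A : SpaceParams) {σ : ℝ} (hσ : |σ| = 1)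
    (hf : SpectrumIn f (M.patch 0 0 (3 * M.radius))) (k : ℕ) :
    spaceNorm M Ψ A (modBlock M σ f k) = 2 ^ (A.s * k) * eLpNorm f A.p volume := by
  rw [spaceNorm_of_core M Ψ A ((spectrumIn_modBlock M hf k).mono (M.patch_subset_core hσ k))]
  congr 1
  exact eLpNorm_congr_enorm_ae (.of_forall fun x => enorm_modBlock M _ _ _ _)

theorem spectrumIn_dilate_neg (hf : SpectrumIn f (M.patch 0 0 (3 * M.radius))) (k : ℕ) :
    SpectrumIn (dilate M (-k) f) (M.core 0) := by
  refine (hf.dilate M (-k) (T := M.patch 0 (-k) (3 * M.radius)) ?_).mono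
    (M.patch_zero_subset_core (by omega))
  rintro _ ⟨y, hy, rfl⟩
  exact ⟨y, hy, by simp [M.dyadicDilation_zero]⟩

theorem spaceNorm_dilate_neg (A : SpaceParams) (hf : SpectrumIn f (M.patch 0 0 (3 * M.radius)))
    (k : ℕ) : spaceNorm M Ψ A (dilate M (-k) f) =
      2 ^ (M.total * A.recip * k) * eLpNorm f A.p volume := by
  rw [spaceNorm_of_core M Ψ A (spectrumIn_dilate_neg hf k), eLpNorm_dilate, SpaceParams.recip,
    Nat.cast_zero, mul_zero, ENNReal.rpow_zero, one_mul]
  congr 2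
  push_cast
  ring

theorem spaceNorm_dilBlock_two (A : SpaceParams)
    (hf : SpectrumIn f (M.patch 0 0 (3 * M.radius))) (k : ℕ) :
    spaceNorm M Ψ A (dilBlock M 2 f k) =
      2 ^ ((A.s - M.total * A.recip) * k) * (2 ^ A.s * eLpNorm f A.p volume) := by
  rw [spaceNorm_of_core M Ψ A (spectrumIn_dilBlock_two hf k), eLpNorm_dilBlock, SpaceParams.recip,
    ← mul_assoc, ← mul_assoc, two_rpow_mul, two_rpow_mul]
  congr 2
  push_cast
  ring

theorem spaceNorm_smul_of_core (A : SpaceParams) {k : ℕ} (hf : SpectrumIn f (M.core k)) (c : ℂ) :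
    spaceNorm M Ψ A (c • f : 𝓢(𝔼, ℂ)) = ‖c‖ₑ * spaceNorm M Ψ A f := by
  rw [spaceNorm_of_core M Ψ A (hf.const_smul c), spaceNorm_of_core M Ψ A hf, FunLike.coe_smul,
    eLpNorm_const_smul, mul_left_comm]

theorem spaceNorm_weightFactor_smul_dilBlock (A : SpaceParams) {σ : ℝ} (hσ : |σ| = 1)
    (hf : SpectrumIn f (M.patch 0 0 (3 * M.radius))) (k : ℕ) :
    spaceNorm M Ψ A (weightFactor (A.s - M.total * A.recip) k • dilBlock M σ f k : 𝓢(𝔼, ℂ)) =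
      eLpNorm f A.p volume := by
  rw [spaceNorm_smul_of_core A (spectrumIn_dilBlock_core M hσ hf k), spaceNorm_dilBlock M Ψ A hσ hf,
    enorm_weightFactor, ← mul_assoc, two_rpow_mul, neg_add_cancel, ENNReal.rpow_zero, one_mul]

theorem eLpNorm_schwartz_ne_top (f : 𝓢(𝔼, ℂ)) (p : ℝ≥0∞) : eLpNorm f p volume ≠ ⊤ :=
  (f.eLpNorm_lt_top p volume).ne

theorem eLpNorm_mul_self_ne_zero (h0 : f 0 ≠ 0) {p : ℝ≥0∞} (hp : p ≠ 0) :
    eLpNorm (schwartzMul f f) p volume ≠ 0 :=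
  eLpNorm_ne_zero (SchwartzMap.continuous _) (x₀ := 0)
    (by rw [schwartzMul_apply]; exact mul_ne_zero h0 h0) hp

theorem enorm_half_mul_eLpNorm_indicator_ne_zero (h0 : f 0 ≠ 0) {p : ℝ≥0∞} (hp : p ≠ 0) :
    ‖f 0‖ₑ / 2 * eLpNorm ((Metric.ball 0 1).indicator f) p volume ≠ 0 :=
  mul_ne_zero (ENNReal.div_ne_zero.mpr ⟨by simpa using h0, by simp⟩)
    (eLpNorm_indicator_ne_zero f.continuous Metric.isOpen_ball (Metric.mem_ball_self one_pos) h0 hp)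

theorem eventually_le_two_rpow_mul_eLpNorm (A : SpaceParams) {u : 𝓢(𝔼, ℂ)} (hu : u 0 ≠ 0) (σ : ℝ)
    (f : 𝓢(𝔼, ℂ)) : ∀ᶠ k : ℕ in atTop,
      2 ^ ((A.s - M.total * A.recip) * k) *
          (‖u 0‖ₑ / 2 * eLpNorm ((Metric.ball 0 1).indicator f) A.p volume) ≤
        2 ^ (A.s * k) * eLpNorm (schwartzMul u (dilBlock M σ f k)) A.p volume := by
  filter_upwards [eventually_le_eLpNorm_mul_dilBlock M (f := f) hu σ A.p] with k hk
  refine le_of_eq_of_le ?_ (mul_le_mul_right hk _)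
  rw [mul_left_comm (‖u 0‖ₑ / 2), ← mul_assoc ((2 : ℝ≥0∞) ^ (A.s * (k : ℝ))), two_rpow_mul,
    SpaceParams.recip]
  congr 2
  ring

theorem exists_le_spaceNorm_dilSum_mul (A : SpaceParams)
    (hf : SpectrumIn f (M.patch 0 0 M.radius)) (h0 : f 0 ≠ 0) {J : Finset ℕ} (hJ : J.Nonempty) :
    ∃ k : ℕ, J.card * (‖f 0‖ₑ / 2 * eLpNorm ((Metric.ball 0 1).indicator f) A.p volume) ≤
      spaceNorm M Ψ A (schwartzMul (blockSum 0 J (dilBlock M 1 f))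
        (weightFactor (A.s - M.total * A.recip) k • dilBlock M 1 f k)) := by
  set u := blockSum 0 J (dilBlock M 1 f)
  have hu : u 0 = J.card * f 0 := dilSum_apply_zero 1 f J
  have hu₀ : u 0 ≠ 0 := by simpa [hu, h0] using hJ.ne_empty
  obtain ⟨k, hk, hlow⟩ := ((eventually_ge_atTop (J.sup id + M.gap)).and
    (eventually_le_two_rpow_mul_eLpNorm (M := M) A hu₀ 1 f)).exists
  have hspec : SpectrumIn (schwartzMul u (dilBlock M 1 f k)) (M.core k) := by
    rw [schwartzMul_blockSum_left]
    refine SpectrumIn.sum fun l hl => SpectrumIn.const_smul ?_ _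
    beta_reduce
    rw [schwartzMul_comm]
    have hlJ : l ≤ J.sup id := Finset.le_sup (f := id) hl
    exact .mul_far (by simp) (by simp) (by omega) (spectrumIn_dilBlock M hf k)
      (spectrumIn_dilBlock M hf l)
  have hsmul (c : ℂ) :
      schwartzMul u (c • dilBlock M 1 f k) = c • schwartzMul u (dilBlock M 1 f k) := by
    simpa using schwartzMul_smul 1 c u (dilBlock M 1 f k)
  have hcard : ‖u 0‖ₑ / 2 = J.card * (‖f 0‖ₑ / 2) := by
    rw [hu, enorm_mul, mul_div_assoc]
    simp [← ofReal_norm]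
  rw [← spaceNorm_of_core M Ψ A hspec] at hlow
  refine ⟨k, ?_⟩
  rw [hsmul, spaceNorm_smul_of_core A hspec, enorm_weightFactor]
  refine le_of_eq_of_le ?_ (mul_le_mul_right hlow _)
  rw [← mul_assoc (2 ^ _), two_rpow_mul, neg_add_cancel, ENNReal.rpow_zero, one_mul, hcard,
    mul_assoc]

end Products

/-! ### Necessary conditions -/

section Exponents

variable {a b c : ℝ≥0∞}

theorem inv_toReal_le_iff (ha : 0 < a) (hb : 0 < b) : (a⁻¹).toReal ≤ (b⁻¹).toReal ↔ b ≤ a := by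
  rw [ENNReal.toReal_le_toReal (ENNReal.inv_ne_top.mpr ha.ne') (ENNReal.inv_ne_top.mpr hb.ne'),
    ENNReal.inv_le_inv]

theorem one_le_inv_toReal_iff (ha : 0 < a) : 1 ≤ (a⁻¹).toReal ↔ a ≤ 1 := by
  rw [← inv_toReal_le_iff one_pos ha, inv_one, ENNReal.toReal_one]

theorem inv_toReal_le_add_iff (ha : 0 < a) (hb : 0 < b) (hc : 0 < c) :
    (c⁻¹).toReal ≤ (a⁻¹).toReal + (b⁻¹).toReal ↔ (a⁻¹ + b⁻¹)⁻¹ ≤ c := by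
  have ha' := ENNReal.inv_ne_top.mpr ha.ne'
  have hb' := ENNReal.inv_ne_top.mpr hb.ne'
  rw [← ENNReal.toReal_add ha' hb', ENNReal.toReal_le_toReal (ENNReal.inv_ne_top.mpr hc.ne')
    (ENNReal.add_ne_top.mpr ⟨ha', hb'⟩), ENNReal.inv_le_iff_inv_le]

theorem one_le_inv_toReal_add_iff (ha : 0 < a) (hb : 0 < b) :
    1 ≤ (a⁻¹).toReal + (b⁻¹).toReal ↔ 1 ≤ a⁻¹ + b⁻¹ := by
  simpa [ENNReal.inv_le_one] using inv_toReal_le_add_iff ha hb one_pos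

end Exponents

section Necessity

variable {M : AnisotropicWeight n} {Ψ : DyadicCutoff} {A₀ A₁ A₂ : SpaceParams}

/-- The estimate `‖f · g‖_{A₂} ≤ c ‖f‖_{A₀} ‖g‖_{A₁}` for the pointwise product of Schwartz
functions. -/
def MulBound (M : AnisotropicWeight n) (Ψ : DyadicCutoff) (A₀ A₁ A₂ : SpaceParams) : Prop :=
  ∃ c : ℝ≥0, ∀ f g : 𝓢(𝔼, ℂ),
    spaceNorm M Ψ A₂ (schwartzMul f g) ≤ c * spaceNorm M Ψ A₀ f * spaceNorm M Ψ A₁ g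

/-- The quasi-norm of a sum of dilated blocks, weighted so that every single block has a quasi-norm
independent of its level, grows at most like the power `α` of the number of blocks. -/
def DilSumBound (M : AnisotropicWeight n) (Ψ : DyadicCutoff) (A : SpaceParams) (α : ℝ) : Prop :=
  ∀ σ : ℝ, |σ| = 1 → ∀ f : 𝓢(𝔼, ℂ), SpectrumIn f (M.patch 0 0 (3 * M.radius)) →
    ∃ C : ℝ≥0∞, C ≠ ⊤ ∧ ∀ J : Finset ℕ, J.Nonempty →
      spaceNorm M Ψ A (blockSum (A.s - M.total * A.recip) J (dilBlock M σ f)) ≤ J.card ^ α * C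

theorem dilSumBound_of_besov {A : SpaceParams} (hA : A.scale = Scale.B) :
    DilSumBound M Ψ A (A.q⁻¹).toReal := fun _ hσ f hf =>
  ⟨_, eLpNorm_schwartz_ne_top f A.p, fun _ hJ => (spaceNorm_dilSum_besov M Ψ hA hσ hJ hf).le⟩

theorem dilSumBound_of_triebel {A : SpaceParams} (hA : A.scale = Scale.F) :
    DilSumBound M Ψ A (A.p⁻¹).toReal := fun _ hσ _ hf =>
  let ⟨C, hC, hbound⟩ := exists_spaceNorm_dilSum_triebel_le M Ψ hA hσ hf
  ⟨C, hC, fun J _ => hbound J⟩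

namespace MulBound

theorem symm (h : MulBound M Ψ A₀ A₁ A₂) : MulBound M Ψ A₁ A₀ A₂ := by
  obtain ⟨c, hc⟩ := h
  refine ⟨c, fun f g => ?_⟩
  rw [schwartzMul_comm, mul_right_comm]
  exact hc g f

theorem exponent_le (h : MulBound M Ψ A₀ A₁ A₂) {t : ℕ → ℝ≥0∞} (ht : Tendsto t atTop (𝓝 ⊤))
    (htop : ∀ N, t N ≠ ⊤) {f g : ℕ → 𝓢(𝔼, ℂ)} {C₀ C₁ c : ℝ≥0∞} (hC₀ : C₀ ≠ ⊤) (hC₁ : C₁ ≠ ⊤)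
    (hc : c ≠ 0) {α β γ : ℝ} (h₀ : ∀ᶠ N in atTop, spaceNorm M Ψ A₀ (f N) ≤ t N ^ α * C₀)
    (h₁ : ∀ᶠ N in atTop, spaceNorm M Ψ A₁ (g N) ≤ t N ^ β * C₁)
    (h₂ : ∀ᶠ N in atTop, t N ^ γ * c ≤ spaceNorm M Ψ A₂ (schwartzMul (f N) (g N))) :
    γ ≤ α + β := by
  obtain ⟨K, hK⟩ := h
  refine exponent_le_of_tendsto_top ht htop hc (c₂ := K * C₀ * C₁)
    (ENNReal.mul_ne_top (ENNReal.mul_ne_top ENNReal.coe_ne_top hC₀) hC₁) ?_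
  filter_upwards [h₀, h₁, h₂, ht.eventually_const_lt ENNReal.zero_lt_top]
    with N hf hg hfg hpos
  calc c * t N ^ γ = t N ^ γ * c := mul_comm _ _
    _ ≤ K * spaceNorm M Ψ A₀ (f N) * spaceNorm M Ψ A₁ (g N) := hfg.trans (hK _ _)
    _ ≤ K * (t N ^ α * C₀) * (t N ^ β * C₁) := by gcongr
    _ = K * C₀ * C₁ * t N ^ (α + β) := by
      rw [ENNReal.rpow_add _ _ hpos.ne' (htop N)]
      ring

theorem exponent_le_of_scale (h : MulBound M Ψ A₀ A₁ A₂) {f g : ℕ → 𝓢(𝔼, ℂ)} {C₀ C₁ c : ℝ≥0∞}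
    (hC₀ : C₀ ≠ ⊤) (hC₁ : C₁ ≠ ⊤) (hc : c ≠ 0) {α β γ : ℝ}
    (h₀ : ∀ k, spaceNorm M Ψ A₀ (f k) = 2 ^ (α * k) * C₀)
    (h₁ : ∀ k, spaceNorm M Ψ A₁ (g k) = 2 ^ (β * k) * C₁)
    (h₂ : ∀ᶠ k : ℕ in atTop, 2 ^ (γ * k) * c ≤ spaceNorm M Ψ A₂ (schwartzMul (f k) (g k))) :
    γ ≤ α + β := by
  have hpow (k : ℕ) (a : ℝ) : ((2 : ℝ≥0∞) ^ k) ^ a = 2 ^ (a * k) := by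
    rw [← ENNReal.rpow_natCast, ← ENNReal.rpow_mul, mul_comm]
  refine h.exponent_le (t := fun k => 2 ^ k) (f := f) (g := g)
    (ENNReal.tendsto_pow_atTop_nhds_top_iff.mpr (by norm_num)) (by simp) hC₀ hC₁ hc ?_ ?_ ?_
  · exact .of_forall fun k => by rw [hpow, h₀]
  · exact .of_forall fun k => by rw [hpow, h₁]
  · simpa only [hpow] using h₂

theorem exponent_le_of_card (h : MulBound M Ψ A₀ A₁ A₂) {f g : Finset ℕ → 𝓢(𝔼, ℂ)}
    {C₀ C₁ c : ℝ≥0∞} (hC₀ : C₀ ≠ ⊤) (hC₁ : C₁ ≠ ⊤) (hc : c ≠ 0) {α β γ : ℝ} (K : ℕ)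
    (h₀ : ∀ J : Finset ℕ, J.Nonempty → spaceNorm M Ψ A₀ (f J) ≤ J.card ^ α * C₀)
    (h₁ : ∀ J : Finset ℕ, J.Nonempty → spaceNorm M Ψ A₁ (g J) ≤ J.card ^ β * C₁)
    (h₂ : ∀ J : Finset ℕ, J.Nonempty → Sparse M.gap J → (∀ k ∈ J, K ≤ k) →
      J.card ^ γ * c ≤ spaceNorm M Ψ A₂ (schwartzMul (f J) (g J))) :
    γ ≤ α + β := by
  choose J hcard hsparse hK using exists_sparse M.gap_ne_zero K
  have hne : ∀ᶠ N in atTop, (J N).Nonempty := by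
    filter_upwards [eventually_gt_atTop 0] with N hN
    rwa [← Finset.card_pos, hcard]
  refine h.exponent_le (t := fun N => N) (f := fun N => f (J N)) (g := fun N => g (J N))
    ENNReal.tendsto_nat_nhds_top ENNReal.natCast_ne_top hC₀ hC₁ hc ?_ ?_ ?_ <;>
    filter_upwards [hne] with N hN
  · simpa only [hcard] using h₀ (J N) hN
  · simpa only [hcard] using h₁ (J N) hN
  · simpa only [hcard] using h₂ (J N) hN (hsparse N) (hK N)

theorem zero_le_add (h : MulBound M Ψ A₀ A₁ A₂) : 0 ≤ A₀.s + A₁.s := by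
  obtain ⟨f, hf, h0, -⟩ := exists_profile M
  refine h.exponent_le_of_scale (f := modBlock M 1 f) (g := modBlock M (-1) f)
    (eLpNorm_schwartz_ne_top f A₀.p) (eLpNorm_schwartz_ne_top f A₁.p)
    (eLpNorm_mul_self_ne_zero h0 A₂.p_pos.ne')
    (spaceNorm_modBlock A₀ (by simp) hf.patch_three)
    (spaceNorm_modBlock A₁ (by simp) hf.patch_three) (.of_forall fun k => ?_)
  rw [schwartzMul_modBlock_neg, spaceNorm_of_low A₂ hf.mul_self, zero_mul, ENNReal.rpow_zero,
    one_mul]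

theorem one_le_inv_add_inv_of_add_eq_zero (h : MulBound M Ψ A₀ A₁ A₂) (hs : A₀.s + A₁.s = 0) :
    1 ≤ A₀.q⁻¹ + A₁.q⁻¹ := by
  rw [← one_le_inv_toReal_add_iff A₀.q_pos A₁.q_pos]
  obtain ⟨f, hf, h0, -⟩ := exists_profile M
  refine h.exponent_le_of_card (f := fun J => blockSum A₀.s J (modBlock M 1 f))
    (g := fun J => blockSum A₁.s J (modBlock M (-1) f))
    (eLpNorm_schwartz_ne_top f A₀.p) (eLpNorm_schwartz_ne_top f A₁.p)
    (eLpNorm_mul_self_ne_zero h0 A₂.p_pos.ne') 1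
    (fun J hJ => (spaceNorm_modSum M Ψ A₀ (by simp) hJ hf.patch_three).le)
    (fun J hJ => (spaceNorm_modSum M Ψ A₁ (by simp) hJ hf.patch_three).le)
    fun J _ hsparse hJ₁ => le_of_eq_of_le ?_ (le_spaceNorm M Ψ A₂ _ 0)
  have hJ₀ : 0 ∉ J := fun h0 => by simpa using hJ₁ 0 h0
  rw [bandPart_modSum_mul_modSum_neg hf hsparse hJ₀ hs, eLpNorm_const_smul]
  simp [← ofReal_norm]

theorem smoothness_le (h : MulBound M Ψ A₀ A₁ A₂) : A₂.s ≤ A₀.s := by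
  obtain ⟨f, hf, h0, -⟩ := exists_profile M
  rw [← add_zero A₀.s]
  refine h.exponent_le_of_scale (f := modBlock M 1 f) (g := fun _ => f)
    (eLpNorm_schwartz_ne_top f A₀.p) (eLpNorm_schwartz_ne_top f A₁.p)
    (eLpNorm_mul_self_ne_zero h0 A₂.p_pos.ne')
    (spaceNorm_modBlock A₀ (by simp) hf.patch_three)
    (fun k => by simp [spaceNorm_of_low A₁ hf.patch_three]) (.of_forall fun k => ?_)
  rw [schwartzMul_modBlock, spaceNorm_modBlock A₂ (by simp) hf.mul_self]

theorem sum_exponent_le_of_smoothness_eq (h : MulBound M Ψ A₀ A₁ A₂) (hs : A₂.s = A₀.s) :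
    A₀.q ≤ A₂.q := by
  rw [← inv_toReal_le_iff A₂.q_pos A₀.q_pos, ← add_zero (A₀.q⁻¹).toReal]
  obtain ⟨f, hf, h0, -⟩ := exists_profile M
  refine h.exponent_le_of_card (f := fun J => blockSum A₀.s J (modBlock M 1 f)) (g := fun _ => f)
    (eLpNorm_schwartz_ne_top f A₀.p) (eLpNorm_schwartz_ne_top f A₁.p)
    (eLpNorm_mul_self_ne_zero h0 A₂.p_pos.ne') 0
    (fun J hJ => (spaceNorm_modSum M Ψ A₀ (by simp) hJ hf.patch_three).le)
    (fun J _ => by simp [spaceNorm_of_low A₁ hf.patch_three]) fun J hJ _ _ => ?_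
  rw [schwartzMul_blockSum_left, ← hs]
  simp only [schwartzMul_modBlock]
  rw [spaceNorm_modSum M Ψ A₂ (by simp) hJ hf.mul_self]

theorem recip_le (h : MulBound M Ψ A₀ A₁ A₂) : A₂.recip ≤ A₀.recip + A₁.recip := by
  obtain ⟨f, hf, h0, -⟩ := exists_profile M
  refine le_of_mul_le_mul_left ?_ M.total_pos
  rw [mul_add]
  refine h.exponent_le_of_scale (f := fun k => dilate M (-k) f) (g := fun k => dilate M (-k) f)
    (eLpNorm_schwartz_ne_top f A₀.p) (eLpNorm_schwartz_ne_top f A₁.p)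
    (eLpNorm_mul_self_ne_zero h0 A₂.p_pos.ne') (spaceNorm_dilate_neg A₀ hf.patch_three)
    (spaceNorm_dilate_neg A₁ hf.patch_three) (.of_forall fun k => ?_)
  rw [schwartzMul_dilate, spaceNorm_dilate_neg A₂ hf.mul_self]

theorem differentialDimension_le (h : MulBound M Ψ A₀ A₁ A₂) :
    A₂.s - M.total * A₂.recip ≤ A₀.s - M.total * A₀.recip := by
  obtain ⟨f, hf, h0, -⟩ := exists_profile M
  rw [← add_zero (A₀.s - M.total * A₀.recip)]
  refine h.exponent_le_of_scale (f := dilBlock M 1 f) (g := fun _ => f)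
    (eLpNorm_schwartz_ne_top f A₀.p) (eLpNorm_schwartz_ne_top f A₁.p)
    (enorm_half_mul_eLpNorm_indicator_ne_zero h0 A₂.p_pos.ne')
    (spaceNorm_dilBlock M Ψ A₀ (by simp) hf.patch_three)
    (fun k => by simp [spaceNorm_of_low A₁ hf.patch_three]) ?_
  filter_upwards [eventually_le_two_rpow_mul_eLpNorm A₂ h0 1 f] with k hk
  rwa [spaceNorm_of_core M Ψ A₂ ((spectrumIn_dilBlock M hf k).mul_low (by simp) hf),
    schwartzMul_comm]

theorem sum_exponent_le_of_differentialDimension_eq (h : MulBound M Ψ A₀ A₁ A₂)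
    (hs : A₂.s - M.total * A₂.recip = A₀.s - M.total * A₀.recip) (hA₀ : A₀.scale = Scale.B)
    (hA₂ : A₂.scale = Scale.B) : A₀.q ≤ A₂.q := by
  rw [← inv_toReal_le_iff A₂.q_pos A₀.q_pos, ← add_zero (A₀.q⁻¹).toReal]
  obtain ⟨f, hf, h0, -⟩ := exists_profile M
  obtain ⟨K, hK⟩ := eventually_atTop.mp
    (eventually_le_two_rpow_mul_eLpNorm (M := M) A₂ h0 1 f)
  refine h.exponent_le_of_card
    (f := fun J => blockSum (A₀.s - M.total * A₀.recip) J (dilBlock M 1 f)) (g := fun _ => f)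
    (eLpNorm_schwartz_ne_top f A₀.p) (eLpNorm_schwartz_ne_top f A₁.p)
    (enorm_half_mul_eLpNorm_indicator_ne_zero h0 A₂.p_pos.ne') K
    (fun J hJ => (spaceNorm_dilSum_besov M Ψ hA₀ (by simp) hJ hf.patch_three).le)
    (fun J _ => by simp [spaceNorm_of_low A₁ hf.patch_three]) fun J hJ _ hJK => ?_
  rw [schwartzMul_blockSum_left, ← hs]
  refine le_spaceNorm_of_besov M Ψ hA₂ hJ fun k hk => ?_
  have hband : bandPart (Ψ.dyadicSchwartz M k) (blockSum (A₂.s - M.total * A₂.recip) J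
      fun k => schwartzMul (dilBlock M 1 f k) f) =
      weightFactor (A₂.s - M.total * A₂.recip) k • ⇑(schwartzMul f (dilBlock M 1 f k)) := by
    ext x
    rw [blockSum, bandPart_sum_core M Ψ fun l _ =>
      ((spectrumIn_dilBlock M hf l).mul_low (by simp) hf).const_smul _, if_pos hk,
      schwartzMul_comm]
    rfl
  rw [hband, eLpNorm_const_smul, enorm_weightFactor, mul_left_comm]
  refine le_of_eq_of_le ?_ (mul_le_mul_right (hK k (hJK k hk)) _)
  rw [← mul_assoc, two_rpow_mul, neg_add_cancel, ENNReal.rpow_zero, one_mul]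

theorem differentialDimension_le_add (h : MulBound M Ψ A₀ A₁ A₂) :
    A₂.s - M.total * A₂.recip ≤
      (A₀.s - M.total * A₀.recip) + (A₁.s - M.total * A₁.recip) := by
  obtain ⟨f, hf, h0, -⟩ := exists_profile M
  refine h.exponent_le_of_scale (f := dilBlock M 1 f) (g := dilBlock M 1 f)
    (eLpNorm_schwartz_ne_top f A₀.p) (eLpNorm_schwartz_ne_top f A₁.p)
    (mul_ne_zero (two_rpow_ne_zero A₂.s) (eLpNorm_mul_self_ne_zero h0 A₂.p_pos.ne'))
    (spaceNorm_dilBlock M Ψ A₀ (by simp) hf.patch_three)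
    (spaceNorm_dilBlock M Ψ A₁ (by simp) hf.patch_three) (.of_forall fun k => ?_)
  rw [schwartzMul_dilBlock, one_add_one_eq_two, spaceNorm_dilBlock_two A₂ hf.mul_self]

theorem inv_add_inv_inv_le_of_differentialDimension_eq_add (h : MulBound M Ψ A₀ A₁ A₂)
    (hs : A₂.s - M.total * A₂.recip =
      (A₀.s - M.total * A₀.recip) + (A₁.s - M.total * A₁.recip))
    (hA₀ : A₀.scale = Scale.B) (hA₁ : A₁.scale = Scale.B) (hA₂ : A₂.scale = Scale.B) :
    (A₀.q⁻¹ + A₁.q⁻¹)⁻¹ ≤ A₂.q := by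
  rw [← inv_toReal_le_add_iff A₀.q_pos A₁.q_pos A₂.q_pos]
  obtain ⟨f, hf, h0, -⟩ := exists_profile M
  refine h.exponent_le_of_card
    (f := fun J => blockSum (A₀.s - M.total * A₀.recip) J (dilBlock M 1 f))
    (g := fun J => blockSum (A₁.s - M.total * A₁.recip) J (dilBlock M 1 f))
    (eLpNorm_schwartz_ne_top f A₀.p) (eLpNorm_schwartz_ne_top f A₁.p)
    (mul_ne_zero (two_rpow_ne_zero A₂.s) (eLpNorm_mul_self_ne_zero h0 A₂.p_pos.ne')) 0
    (fun J hJ => (spaceNorm_dilSum_besov M Ψ hA₀ (by simp) hJ hf.patch_three).le)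
    (fun J hJ => (spaceNorm_dilSum_besov M Ψ hA₁ (by simp) hJ hf.patch_three).le)
    fun J hJ hsparse _ => ?_
  rw [← Finset.card_image_of_injective J (add_left_injective 1)]
  refine le_spaceNorm_of_besov M Ψ hA₂ (hJ.image _) fun j hj => le_of_eq ?_
  obtain ⟨k, hk, rfl⟩ := Finset.mem_image.mp hj
  have hblock : SpectrumIn (dilBlock M 2 (schwartzMul f f) k) (M.core (k + 1)) :=
    spectrumIn_dilBlock_two hf.mul_self k
  rw [bandPart_dilSum_mul_dilSum hf hsparse _ _ hk, ← hs, eLpNorm_const_smul, mul_left_comm,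
    ← spaceNorm_of_core M Ψ A₂ hblock, spaceNorm_dilBlock_two A₂ hf.mul_self,
    enorm_weightFactor, ← mul_assoc (2 ^ _) (2 ^ _) (2 ^ _ * _), two_rpow_mul, neg_add_cancel,
    ENNReal.rpow_zero, one_mul]

theorem neg_total_le (h : MulBound M Ψ A₀ A₁ A₂) :
    -M.total ≤ (A₀.s - M.total * A₀.recip) + (A₁.s - M.total * A₁.recip) := by
  obtain ⟨f, hf, -, h0⟩ := exists_profile M
  obtain ⟨c, hc, K, hK⟩ := exists_le_eLpNorm_bandPart_dilates M Ψ h0 A₂.p_pos.ne'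
  refine h.exponent_le_of_scale (f := dilBlock M 1 f) (g := dilBlock M (-1) f)
    (eLpNorm_schwartz_ne_top f A₀.p) (eLpNorm_schwartz_ne_top f A₁.p) hc
    (spaceNorm_dilBlock M Ψ A₀ (by simp) hf.patch_three)
    (spaceNorm_dilBlock M Ψ A₁ (by simp) hf.patch_three) ?_
  filter_upwards [eventually_ge_atTop K] with k hk
  have hlow : c ≤ 2 ^ (M.total * k) * eLpNorm (bandPart (Ψ.dyadicSchwartz M 0)
      (dilate M k (schwartzMul f f))) A₂.p volume := by
    rw [← neg_neg (M.total * k), ← neg_mul, ← enorm_weightFactor, ← eLpNorm_const_smul]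
    simpa [Pi.smul_def] using hK {k} (by simpa using hk)
  rw [schwartzMul_dilBlock, add_neg_cancel, dilBlock_zero]
  refine le_trans ?_ (le_spaceNorm M Ψ A₂ _ 0)
  refine (mul_le_mul_right hlow _).trans_eq ?_
  rw [← mul_assoc, two_rpow_mul, neg_mul, neg_add_cancel, Nat.cast_zero, mul_zero]

theorem one_le_add_of_dilSumBound (h : MulBound M Ψ A₀ A₁ A₂)
    (hs : A₀.s + A₁.s = M.total * A₀.recip + M.total * A₁.recip - M.total) {α β : ℝ}
    (h₀ : DilSumBound M Ψ A₀ α) (h₁ : DilSumBound M Ψ A₁ β) : 1 ≤ α + β := by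
  obtain ⟨f, hf, -, h0⟩ := exists_profile M
  obtain ⟨c, hc, K, hK⟩ := exists_le_eLpNorm_bandPart_dilates M Ψ h0 A₂.p_pos.ne'
  obtain ⟨C₀, hC₀, hbound₀⟩ := h₀ 1 (by simp) f hf.patch_three
  obtain ⟨C₁, hC₁, hbound₁⟩ := h₁ (-1) (by simp) f hf.patch_three
  refine h.exponent_le_of_card hC₀ hC₁ hc (max 1 K) hbound₀ hbound₁ fun J _ hsparse hJ => ?_
  have hJ₀ : 0 ∉ J := fun h0 => by simpa using hJ 0 h0
  have hweight : (A₀.s - M.total * A₀.recip) + (A₁.s - M.total * A₁.recip) = -M.total := by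
    linarith
  refine le_trans ?_ (le_spaceNorm M Ψ A₂ _ 0)
  rw [bandPart_dilSum_mul_dilSum_neg hf hsparse hJ₀, hweight, Nat.cast_zero, mul_zero,
    ENNReal.rpow_zero, one_mul, ENNReal.rpow_one]
  exact hK J fun k hk => (le_max_right 1 K).trans (hJ k hk)

theorem one_le_of_dilSumBound (h : MulBound M Ψ A₀ A₁ A₂)
    (hs₁ : A₂.s - M.total * A₂.recip = A₁.s - M.total * A₁.recip)
    (hs₀ : A₀.s = M.total * A₀.recip) {α : ℝ} (h₀ : DilSumBound M Ψ A₀ α) : 1 ≤ α := by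
  obtain ⟨f, hf, h0, -⟩ := exists_profile M
  obtain ⟨C₀, hC₀, hbound₀⟩ := h₀ 1 (by simp) f hf.patch_three
  rw [hs₀, sub_self] at hbound₀
  choose! k hk using fun (J : Finset ℕ) (hJ : J.Nonempty) =>
    exists_le_spaceNorm_dilSum_mul (Ψ := Ψ) A₂ hf h0 hJ
  rw [← add_zero α]
  refine h.exponent_le_of_card
    (g := fun J => weightFactor (A₁.s - M.total * A₁.recip) (k J) • dilBlock M 1 f (k J))
    hC₀ (eLpNorm_schwartz_ne_top f A₁.p)
    (enorm_half_mul_eLpNorm_indicator_ne_zero h0 A₂.p_pos.ne') 0 hbound₀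
    (fun J _ => ?_) fun J hJ _ _ => ?_
  · rw [spaceNorm_weightFactor_smul_dilBlock A₁ (by simp) hf.patch_three, ENNReal.rpow_zero,
      one_mul]
  · rw [← hs₁, ENNReal.rpow_one]
    exact hk J hJ

end MulBound

end Necessity

end

theorem mainTheorem2 {n : ℕ} (M : AnisotropicWeight n) (Ψ : DyadicCutoff)
    (A₀ A₁ A₂ : SpaceParams)
    (h :
      -- the pointwise product of Schwartz functions satisfies the estimate
      (∃ c : ℝ≥0, ∀ f g : 𝓢(EuclideanSpace ℝ (Fin n), ℂ),
        spaceNorm M Ψ A₂ (schwartzMul f g) ≤ c * spaceNorm M Ψ A₀ f * spaceNorm M Ψ A₁ g) ∨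
      -- the product `π` satisfies the estimate
      (∃ c : ℝ≥0, ∀ (f g : 𝓢(EuclideanSpace ℝ (Fin n), ℂ))
        (w : 𝓢'(EuclideanSpace ℝ (Fin n), ℂ)), IsProduct M f g w →
        spaceNorm M Ψ A₂ w ≤ c * spaceNorm M Ψ A₀ f * spaceNorm M Ψ A₁ g)) :
    -- (1)
    A₀.s + A₁.s ≥ M.total * (A₀.recip + A₁.recip - 1) ∧
    -- (2)
    A₀.s + A₁.s ≥ 0 ∧
    -- (3)
    A₂.s ≤ min A₀.s A₁.s ∧
    -- (4)
    A₂.recip ≤ A₀.recip + A₁.recip ∧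
    -- (5)
    A₂.s - M.total * A₂.recip ≤
      min (A₀.s - M.total * A₀.recip) (A₁.s - M.total * A₁.recip) ∧
    -- (6)
    A₂.s - M.total * A₂.recip ≤ A₀.s + A₁.s - M.total * (A₀.recip + A₁.recip) ∧
    -- (7)
    (A₂.s - M.total * A₂.recip = A₁.s - M.total * A₁.recip →
      A₀.s = M.total * A₀.recip →
      (A₀.scale = Scale.B → A₀.q ≤ 1) ∧ (A₀.scale = Scale.F → A₀.p ≤ 1)) ∧
    -- (1')
    (A₀.s + A₁.s = M.total * A₀.recip + M.total * A₁.recip - M.total →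
      (A₀.scale = Scale.B → A₁.scale = Scale.B → A₀.q⁻¹ + A₁.q⁻¹ ≥ 1) ∧
      (A₀.scale = Scale.B → A₁.scale = Scale.F → A₀.q⁻¹ + A₁.p⁻¹ ≥ 1)) ∧
    -- (2')
    (A₀.s + A₁.s = 0 → A₀.q⁻¹ + A₁.q⁻¹ ≥ 1) ∧
    -- (3'), for `j = 0` and `j = 1`
    (A₂.s = A₀.s → A₂.q ≥ A₀.q) ∧
    (A₂.s = A₁.s → A₂.q ≥ A₁.q) ∧
    -- (5'), for `j = 0` and `j = 1`
    (A₂.s - M.total * A₂.recip = A₀.s - M.total * A₀.recip →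
      A₀.scale = Scale.B → A₂.scale = Scale.B → A₂.q ≥ A₀.q) ∧
    (A₂.s - M.total * A₂.recip = A₁.s - M.total * A₁.recip →
      A₁.scale = Scale.B → A₂.scale = Scale.B → A₂.q ≥ A₁.q) ∧
    -- (6')
    (A₂.s - M.total * A₂.recip =
        A₀.s - M.total * A₀.recip + A₁.s - M.total * A₁.recip →
      A₀.scale = Scale.B → A₁.scale = Scale.B → A₂.scale = Scale.B →
      A₂.q ≥ (A₀.q⁻¹ + A₁.q⁻¹)⁻¹) := by
  have hmul : MulBound M Ψ A₀ A₁ A₂ := h.elim id fun ⟨c, hc⟩ =>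
    ⟨c, fun f g => hc f g _ (isProduct_schwartzMul M f g)⟩
  refine ⟨?_, hmul.zero_le_add, le_min hmul.smoothness_le hmul.symm.smoothness_le, hmul.recip_le,
    le_min hmul.differentialDimension_le hmul.symm.differentialDimension_le, ?_,
    fun hs hs₀ => ⟨fun hA₀ => ?_, fun hA₀ => ?_⟩,
    fun hs => ⟨fun hA₀ hA₁ => ?_, fun hA₀ hA₁ => ?_⟩,
    hmul.one_le_inv_add_inv_of_add_eq_zero, hmul.sum_exponent_le_of_smoothness_eq,
    hmul.symm.sum_exponent_le_of_smoothness_eq, hmul.sum_exponent_le_of_differentialDimension_eq,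
    hmul.symm.sum_exponent_le_of_differentialDimension_eq, fun hs =>
      hmul.inv_add_inv_inv_le_of_differentialDimension_eq_add (hs.trans (add_sub_assoc _ _ _))⟩
  · linarith [hmul.neg_total_le]
  · linarith [hmul.differentialDimension_le_add]
  · exact (one_le_inv_toReal_iff A₀.q_pos).mp
      (hmul.one_le_of_dilSumBound hs hs₀ (dilSumBound_of_besov hA₀))
  · exact (one_le_inv_toReal_iff A₀.p_pos).mp
      (hmul.one_le_of_dilSumBound hs hs₀ (dilSumBound_of_triebel hA₀))
  · exact (one_le_inv_toReal_add_iff A₀.q_pos A₁.q_pos).mp (hmul.one_le_add_of_dilSumBound hs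
      (dilSumBound_of_besov hA₀) (dilSumBound_of_besov hA₁))
  · exact (one_le_inv_toReal_add_iff A₀.q_pos A₁.p_pos).mp (hmul.one_le_add_of_dilSumBound hs
      (dilSumBound_of_besov hA₀) (dilSumBound_of_triebel hA₁))
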